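/- Let $\alpha\in\mathbb R\cup\{+\infty\}$. Let $\Gamma_0$ be the infinite chain graph made of rings numbered by $n\in\mathbb Z$, each ring consisting of two edges (an upper and a lower semicircle) of length $\pi$, both parametrized by $x\in[0,\pi]$ from left to right; the right ends $x=\pi$ of the two edges of ring $n-1$ and the left ends $x=0$ of the two edges of ring $n$ are identified to a single vertex, for every $n\in\mathbb Z$. Let $H_0$ be the operator in the Hilbert space $L^2(\Gamma_0)=\bigoplus_{e}L^2(0,\pi)$ (the sum runs over all edges $e$) that acts as $\psi\mapsto-\psi''$ on every edge. Its domain consists of all $\psi\in L^2(\Gamma_0)$ whose restriction to every edge is in $W^{2,2}(0,\pi)$, with $\psi''\in L^2(\Gamma_0)$, and which satisfy the $\delta$-coupling with constant $\alpha$ at every vertex: the four boundary values at the vertex coincide, and the sum of the four derivatives at the vertex, taken in the directions pointing away from it, equals $\alpha$ times this common value; for $\alpha=+\infty$ the latter condition means that the common value is $0$. If $\kappa>0$, then $-\kappa^2\in\sigma(H_0)$ if and only if $$\left|\cosh\kappa\pi+\frac{\alpha}{4}\cdot\frac{\sinh\kappa\pi}{\kappa}\right|\le 1,$$ where for $\alpha=+\infty$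 the left-hand side is $+\infty$, so that the condition fails. -/

import Mathlib

open MeasureTheory Set

noncomputable section

namespace ChainGraph

/-- Spectrum of a (possibly unbounded) linear operator `T` on a complex normed space: `z` is *not* in
the spectrum iff `T - z` is a bijection from the domain of `T` onto the whole space whose inverse `R`
is a bounded operator. -/
def spectrum {E : Type*} [NormedAddCommGroup E] [NormedSpace ℂ E] (T : E →ₗ.[ℂ] E) : Set ℂ :=
  {z | ¬ ∃ R : E →L[ℂ] E,
    (∀ y : E, ∃ h : R y ∈ T.domain, T ⟨R y, h⟩ - z • R y = y) ∧
    (∀ x : T.domain, R (T x - z • (x : E)) = x)}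

/-- The edges of the chain graph `Γ₀`: the ring number `n : ℤ` consists of the two semicircles
`(n, true)` (upper) and `(n, false)` (lower), each of length `π` and parametrized by `[0, π]` from
left to right. -/
abbrev Edge : Type := ℤ × Bool

/-- `L²` of one edge. -/
abbrev EdgeL2 : Type := Lp ℂ 2 (volume.restrict (Icc (0 : ℝ) Real.pi))

/-- The state Hilbert space `L²(Γ₀)`: the Hilbert-space direct sum of the spaces `L²(0, π)` over all
the edges. -/
abbrev StateSpace : Type := lp (fun _ : Edge => EdgeL2) 2

/-- `IsH2 f g u v` says that `f ∈ L²(0, π)` belongs to `W^{2,2}(0, π)`, with (weak) second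
derivative `g ∈ L²(0, π)`: the function `f` has a representative `u` that is `C¹` on `[0, π]`, with
derivative `v` (one-sided at the end points), and `v` is absolutely continuous, being a primitive of
`g`. The values of `u` and `v` on `[0, π]` are determined by `f`; those at `0` and `π` are the
boundary values of the function and of its derivative. -/
structure IsH2 (f g : EdgeL2) (u v : ℝ → ℂ) : Prop where
  ae_eq : ∀ᵐ x ∂(volume.restrict (Icc (0 : ℝ) Real.pi)), f x = u x
  hasDeriv : ∀ x ∈ Icc (0 : ℝ) Real.pi, HasDerivWithinAt u (v x) (Icc (0 : ℝ) Real.pi) x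
  eq_integral : ∀ x ∈ Icc (0 : ℝ) Real.pi, v x = v 0 + ∫ t in (0 : ℝ)..x, g t

/-- The `δ`-coupling with coupling constant `α ∈ ℝ ∪ {+∞}` at the contact point number `n`, where
the right ends (coordinate `π`) of the two edges of ring `n - 1` meet the left ends (coordinate `0`)
of the two edges of ring `n`; `u e` is the function on the edge `e`, and `v e` its derivative. The
four boundary values have a common value `c`, and the sum of the four derivatives in the directions
pointing away from the vertex is `α c`; for `α = +∞` this is the Dirichlet condition `c = 0`. -/
def DeltaCoupling (α : EReal) (u v : Edge → ℝ → ℂ) (n : ℤ) : Prop :=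
  ∃ c : ℂ, (∀ b : Bool, u (n - 1, b) Real.pi = c) ∧ (∀ b : Bool, u (n, b) 0 = c) ∧
    if α = ⊤ then c = 0
    else (∑ b : Bool, v (n, b) 0) - (∑ b : Bool, v (n - 1, b) Real.pi) = (α.toReal : ℂ) * c

lemma edge_integrable (g : EdgeL2) : IntegrableOn g (Icc (0 : ℝ) Real.pi) volume :=
  (Lp.memLp g).integrable (by norm_num)

lemma edge_intervalIntegrable (g : EdgeL2) {x : ℝ} (hx : x ∈ Icc (0 : ℝ) Real.pi) :
    IntervalIntegrable g volume 0 x := by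
  rw [intervalIntegrable_iff_integrableOn_Ioc_of_le hx.1]
  exact (edge_integrable g).mono_set fun t ht => ⟨ht.1.le, ht.2.trans hx.2⟩

lemma edge_integral_congr {g : EdgeL2} {h : ℝ → ℂ}
    (H : g =ᵐ[volume.restrict (Icc (0 : ℝ) Real.pi)] h) {x : ℝ}
    (hx : x ∈ Icc (0 : ℝ) Real.pi) :
    ∫ t in (0 : ℝ)..x, g t = ∫ t in (0 : ℝ)..x, h t := by
  rw [intervalIntegral.integral_of_le hx.1, intervalIntegral.integral_of_le hx.1]
  exact integral_congr_ae
    (ae_restrict_of_ae_restrict_of_subset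
      (fun t (ht : t ∈ Ioc 0 x) => (⟨ht.1.le, ht.2.trans hx.2⟩ : t ∈ Icc (0 : ℝ) Real.pi)) H)

lemma IsH2.zero : IsH2 0 0 0 0 where
  ae_eq := Lp.coeFn_zero _ _ _
  hasDeriv x _ := hasDerivWithinAt_const x _ (0 : ℂ)
  eq_integral x hx := by
    rw [edge_integral_congr (Lp.coeFn_zero _ _ _) hx]; simp

lemma IsH2.add {f g f' g' : EdgeL2} {u v u' v' : ℝ → ℂ} (h : IsH2 f g u v)
    (h' : IsH2 f' g' u' v') : IsH2 (f + f') (g + g') (u + u') (v + v') where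
  ae_eq := by
    filter_upwards [Lp.coeFn_add f f', h.ae_eq, h'.ae_eq] with x h1 h2 h3
    exact h1.trans (congrArg₂ (· + ·) h2 h3)
  hasDeriv x hx := (h.hasDeriv x hx).add (h'.hasDeriv x hx)
  eq_integral x hx := by
    rw [edge_integral_congr (Lp.coeFn_add _ _) hx]
    simp only [Pi.add_apply]
    rw [intervalIntegral.integral_add (edge_intervalIntegrable g hx)
      (edge_intervalIntegrable g' hx), h.eq_integral x hx, h'.eq_integral x hx]
    ring

lemma IsH2.smul {f g : EdgeL2} {u v : ℝ → ℂ} (a : ℂ) (h : IsH2 f g u v) :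
    IsH2 (a • f) (a • g) (a • u) (a • v) where
  ae_eq := by
    filter_upwards [Lp.coeFn_smul a f, h.ae_eq] with x h1 h2
    exact h1.trans (congrArg (a • ·) h2)
  hasDeriv x hx := (h.hasDeriv x hx).const_smul a
  eq_integral x hx := by
    rw [edge_integral_congr (Lp.coeFn_smul _ _) hx]
    simp only [Pi.smul_apply, intervalIntegral.integral_smul]
    rw [h.eq_integral x hx, smul_add]

/-- The second derivative is determined by the function. -/
lemma IsH2.eq_zero {g : EdgeL2} {u v : ℝ → ℂ} (h : IsH2 0 g u v) : g = 0 := by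
  have hu : EqOn u 0 (Icc (0 : ℝ) Real.pi) := by
    refine Measure.eqOn_Icc_of_ae_eq volume Real.pi_pos.ne ?_
      (fun x hx => (h.hasDeriv x hx).continuousWithinAt) continuousOn_const
    filter_upwards [h.ae_eq, Lp.coeFn_zero ℂ 2 (volume.restrict (Icc (0 : ℝ) Real.pi))]
      with x h1 h2
    rw [← h1, h2]
  have hv : ∀ x ∈ Icc (0 : ℝ) Real.pi, v x = 0 := fun x hx =>
    (uniqueDiffOn_Icc Real.pi_pos x hx).eq_deriv _ (h.hasDeriv x hx)
      ((hasDerivWithinAt_const x _ (0 : ℂ)).congr hu (hu hx))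
  have hI : ∀ x ∈ Icc (0 : ℝ) Real.pi, ∫ t in (0 : ℝ)..x, g t = 0 := fun x hx => by
    have := h.eq_integral x hx
    rw [hv x hx, hv 0 ⟨le_rfl, Real.pi_pos.le⟩, zero_add] at this
    exact this.symm
  have hpi : Real.pi ∈ Icc (0 : ℝ) Real.pi := ⟨Real.pi_pos.le, le_rfl⟩
  have hd := (edge_intervalIntegrable g hpi).ae_hasDerivAt_integral
  refine Lp.eq_zero_iff_ae_eq_zero.mpr ?_
  suffices H : ∀ᵐ x ∂(volume.restrict (Ioo (0 : ℝ) Real.pi)), g x = 0 by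
    rwa [restrict_Ioo_eq_restrict_Icc] at H
  refine (ae_restrict_iff' measurableSet_Ioo).mpr ?_
  filter_upwards [hd] with x hx hxI
  have hx1 := hx (by rw [uIcc_of_le Real.pi_pos.le]; exact Ioo_subset_Icc_self hxI) 0
    (by rw [uIcc_of_le Real.pi_pos.le]; exact ⟨le_rfl, Real.pi_pos.le⟩)
  refine hx1.unique ((hasDerivAt_const x (0 : ℂ)).congr_of_eventuallyEq ?_)
  filter_upwards [Ioo_mem_nhds hxI.1 hxI.2] with y hy
  exact hI y (Ioo_subset_Icc_self hy)

lemma DeltaCoupling.zero (α : EReal) (n : ℤ) : DeltaCoupling α 0 0 n :=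
  ⟨0, by simp, by simp, by split_ifs <;> simp⟩

lemma DeltaCoupling.add {α : EReal} {u v u' v' : Edge → ℝ → ℂ} {n : ℤ}
    (h : DeltaCoupling α u v n) (h' : DeltaCoupling α u' v' n) :
    DeltaCoupling α (u + u') (v + v') n := by
  obtain ⟨c, h1, h2, h3⟩ := h
  obtain ⟨c', h1', h2', h3'⟩ := h'
  refine ⟨c + c', by simp [h1, h1'], by simp [h2, h2'], ?_⟩
  split_ifs at * with hα
  · simp [h3, h3']
  · simp only [Pi.add_apply, Finset.sum_add_distrib]
    linear_combination h3 + h3'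

lemma DeltaCoupling.smul {α : EReal} {u v : Edge → ℝ → ℂ} {n : ℤ} (a : ℂ)
    (h : DeltaCoupling α u v n) : DeltaCoupling α (a • u) (a • v) n := by
  obtain ⟨c, h1, h2, h3⟩ := h
  refine ⟨a * c, by simp [h1], by simp [h2], ?_⟩
  split_ifs at * with hα
  · simp [h3]
  · simp only [Pi.smul_apply, smul_eq_mul, ← Finset.mul_sum]
    linear_combination a * h3

/-- The graph of the Hamiltonian: the pairs `(ψ, -ψ'')` in `L²(Γ₀) × L²(Γ₀)` for which `ψ` is in
`W^{2,2}` on each edge and satisfies the `δ`-coupling at each vertex. -/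
def hamiltonianGraph (α : EReal) : Submodule ℂ (StateSpace × StateSpace) where
  carrier := {p | ∃ u v : Edge → ℝ → ℂ,
    (∀ e : Edge, IsH2 (p.1 e) (-(p.2 e)) (u e) (v e)) ∧ ∀ n : ℤ, DeltaCoupling α u v n}
  zero_mem' := ⟨0, 0, fun e => by simpa using IsH2.zero, DeltaCoupling.zero α⟩
  add_mem' := by
    rintro p q ⟨u, v, h, hn⟩ ⟨u', v', h', hn'⟩
    refine ⟨u + u', v + v', fun e => ?_, fun n => (hn n).add (hn' n)⟩
    have := (h e).add (h' e)
    rw [← neg_add] at this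
    exact this
  smul_mem' := by
    rintro a p ⟨u, v, h, hn⟩
    refine ⟨a • u, a • v, fun e => ?_, fun n => (hn n).smul a⟩
    have := (h e).smul a
    rw [smul_neg] at this
    exact this

/-- The Hamiltonian `H₀` of the chain graph with coupling constant `α ∈ ℝ ∪ {+∞}`: the operator in
`L²(Γ₀)` that acts as `ψ ↦ -ψ''` on every edge; its domain consists of those `ψ` that are in
`W^{2,2}` on every edge, satisfy the `δ`-coupling at every vertex, and have `ψ'' ∈ L²(Γ₀)`. That
`hamiltonianGraph α` is the graph of an operator, namely of this one, is `graph_hamiltonian`. -/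
def hamiltonian (α : EReal) : StateSpace →ₗ.[ℂ] StateSpace :=
  (hamiltonianGraph α).toLinearPMap

theorem graph_hamiltonian (α : EReal) : (hamiltonian α).graph = hamiltonianGraph α := by
  refine Submodule.toLinearPMap_graph_eq _ ?_
  rintro ⟨f, g⟩ ⟨u, v, h, -⟩ hf
  refine lp.ext (funext fun e => ?_)
  have he := h e
  simp only at hf he
  rw [hf] at he
  have := IsH2.eq_zero he
  simpa using this

end ChainGraph

end

/-! For κ > 0 a solution of u'' = κ²u on an edge is determined by its two boundary values, because
sinh κπ ≠ 0. Continuity gives both semicircles of a ring the same values aₙ, aₙ₊₁ at their ends. For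
finite α = r, eliminating the derivatives from the flux condition leaves the scalar recurrence 2D aₙ
= aₙ₊₁ + aₙ₋₁, with D = cosh κπ + (r/4) sinh κπ / κ (`discriminant`). So the question becomes
whether `diffOp D`, that is 2D minus the sum of the two shifts on ℓ², is invertible.

If |D| > 1, it is, since the sum of the shifts has norm at most 2 (`isUnit_diffOp`). The kernel of
H₀ + κ² is then trivial, since boundary values of an L² solution are square summable
(`exists_vertexData`, `eq_zero_of_graph`). The resolvent is explicit: solve -u'' + κ²u = g on each
edge with zero initial data (`volterra`), then add homogeneous solutions. Their vertex values come
from inverting `diffOp D` on a right-hand side read off from g (`deltaCoupling_of_recurrence`,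
`notMem_spectrum_of_vertex_operator`). For α = +∞ the same construction works with all vertex values
zero.

If |D| ≤ 1, then D = cos θ, and truncations of the bounded solution exp(iθn) show that `diffOp D` is
not bounded below (`not_diffOp_bounded_below`). A bounded resolvent would contradict this
(`mem_spectrum_of_le_one`): interpolate vertex data a by homogeneous solutions and repair the flux
condition by a bump on each edge. The result lies in the domain, and H₀ + κ² maps it to something of
size at most a constant times ‖`diffOp D` a‖, so the resolvent would bound ‖a‖ by that quantity. -/

noncomputable section

namespace ChainGraph

/-! ### Primitives of integrable functions -/

/-- Product rule for a smooth function times the primitive of an integrable function. -/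
lemma mul_primitive_eq_integral_real {f φ φ' : ℝ → ℝ} {x : ℝ}
    (hf : IntervalIntegrable f volume 0 x) (hφ : ∀ t, HasDerivAt φ (φ' t) t)
    (hφ' : Continuous φ') :
    φ x * ∫ t in (0 : ℝ)..x, f t =
      ∫ t in (0 : ℝ)..x, (φ' t * (∫ s in (0 : ℝ)..t, f s) + φ t * f t) := by
  have hF := hf.absolutelyContinuousOnInterval_intervalIntegral (c := 0) left_mem_uIcc
  have hφ1 : ContDiff ℝ 1 φ := by
    rw [contDiff_one_iff_deriv]
    refine ⟨fun t => (hφ t).differentiableAt, ?_⟩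
    rwa [show deriv φ = φ' from funext fun t => (hφ t).deriv]
  have hφa : AbsolutelyContinuousOnInterval φ 0 x := hφ1.contDiffOn.absolutelyContinuousOnInterval
  have h := AbsolutelyContinuousOnInterval.integral_deriv_mul_eq_sub hφa hF
  rw [intervalIntegral.integral_same, mul_zero, sub_zero] at h
  rw [← h]
  refine intervalIntegral.integral_congr_ae ?_
  filter_upwards [hf.ae_hasDerivAt_integral] with t ht htx
  rw [(ht (uIoc_subset_uIcc htx) 0 left_mem_uIcc).deriv, (hφ t).deriv]

/-- As φ is real, the identity splits into its real and imaginary parts, each an instance of the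
real product rule. -/
lemma mul_primitive_eq_integral {f : ℝ → ℂ} {φ φ' : ℝ → ℝ} {x : ℝ}
    (hf : IntervalIntegrable f volume 0 x) (hφ : ∀ t, HasDerivAt φ (φ' t) t)
    (hφ' : Continuous φ') :
    (φ x : ℂ) * ∫ t in (0 : ℝ)..x, f t =
      ∫ t in (0 : ℝ)..x, ((φ' t : ℂ) * (∫ s in (0 : ℝ)..t, f s) + (φ t : ℂ) * f t) := by
  have hφc : Continuous φ := continuous_iff_continuousAt.2 fun t => (hφ t).continuousAt
  have hFc : ContinuousOn (fun t => ∫ s in (0 : ℝ)..t, f s) (uIcc 0 x) :=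
    intervalIntegral.continuousOn_primitive_interval
      ((intervalIntegrable_iff').1 hf)
  have hint : IntervalIntegrable
      (fun t => (φ' t : ℂ) * (∫ s in (0 : ℝ)..t, f s) + (φ t : ℂ) * f t) volume 0 x := by
    refine IntervalIntegrable.add ?_ ?_
    · exact ((Complex.continuous_ofReal.comp hφ').continuousOn.mul hFc).intervalIntegrable
    · exact hf.continuousOn_mul (Complex.continuous_ofReal.comp hφc).continuousOn
  have hsub : ∀ t ∈ uIcc (0 : ℝ) x, IntervalIntegrable f volume 0 t := fun t ht =>
    hf.mono_set (uIcc_subset_uIcc left_mem_uIcc ht)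
  have hre : ∀ t ∈ uIcc (0 : ℝ) x, (∫ s in (0 : ℝ)..t, f s).re = ∫ s in (0 : ℝ)..t, (f s).re :=
    fun t ht => (Complex.reCLM.intervalIntegral_comp_comm (hsub t ht)).symm
  have him : ∀ t ∈ uIcc (0 : ℝ) x, (∫ s in (0 : ℝ)..t, f s).im = ∫ s in (0 : ℝ)..t, (f s).im :=
    fun t ht => (Complex.imCLM.intervalIntegral_comp_comm (hsub t ht)).symm
  have hfre : IntervalIntegrable (fun t => (f t).re) volume 0 x :=
    ⟨hf.1.re, hf.2.re⟩
  have hfim : IntervalIntegrable (fun t => (f t).im) volume 0 x :=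
    ⟨hf.1.im, hf.2.im⟩
  refine Complex.ext ?_ ?_
  · have h1 := Complex.reCLM.intervalIntegral_comp_comm hint
    simp only [Complex.reCLM_apply] at h1
    rw [Complex.re_ofReal_mul, hre x right_mem_uIcc,
      mul_primitive_eq_integral_real hfre hφ hφ', ← h1]
    refine intervalIntegral.integral_congr fun t ht => ?_
    simp only [Complex.add_re, Complex.re_ofReal_mul, hre t ht]
  · have h1 := Complex.imCLM.intervalIntegral_comp_comm hint
    simp only [Complex.imCLM_apply] at h1
    rw [Complex.im_ofReal_mul, him x right_mem_uIcc,
      mul_primitive_eq_integral_real hfim hφ hφ', ← h1]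
    refine intervalIntegral.integral_congr fun t ht => ?_
    simp only [Complex.add_im, Complex.im_ofReal_mul, him t ht]

/-! ### Functions on one edge -/

/-- The extension by zero to the real line of a square integrable function on an edge. -/
def edgeExt (g : EdgeL2) : ℝ → ℂ := (Icc (0 : ℝ) Real.pi).indicator g

lemma integrable_edgeExt (g : EdgeL2) : Integrable (edgeExt g) :=
  (integrable_indicator_iff measurableSet_Icc).2 (edge_integrable g)

lemma edgeExt_of_mem (g : EdgeL2) {x : ℝ} (hx : x ∈ Icc (0 : ℝ) Real.pi) : edgeExt g x = g x :=
  indicator_of_mem hx _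

lemma edgeExt_add (g g' : EdgeL2) : edgeExt (g + g') =ᵐ[volume] edgeExt g + edgeExt g' := by
  filter_upwards [(ae_restrict_iff' measurableSet_Icc).1 (Lp.coeFn_add g g')] with x hx
  by_cases h : x ∈ Icc (0 : ℝ) Real.pi
  · simpa [edgeExt, h] using hx h
  · simp only [edgeExt, Pi.add_apply, indicator_of_notMem h, add_zero]

lemma edgeExt_smul (c : ℂ) (g : EdgeL2) : edgeExt (c • g) =ᵐ[volume] c • edgeExt g := by
  filter_upwards [(ae_restrict_iff' measurableSet_Icc).1 (Lp.coeFn_smul c g)] with x hx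
  by_cases h : x ∈ Icc (0 : ℝ) Real.pi
  · simpa [edgeExt, h] using hx h
  · simp only [edgeExt, Pi.smul_apply, indicator_of_notMem h, smul_zero]

lemma integrable_mul_edgeExt {φ : ℝ → ℝ} (hφ : Continuous φ) (g : EdgeL2) :
    Integrable (fun t => (φ t : ℂ) * edgeExt g t) := by
  have h : (fun t => (φ t : ℂ) * edgeExt g t) =
      (Icc (0 : ℝ) Real.pi).indicator (fun t => (φ t : ℂ) * g t) := by
    funext t
    by_cases h : t ∈ Icc (0 : ℝ) Real.pi <;> simp [edgeExt, h]
  rw [h, integrable_indicator_iff measurableSet_Icc]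
  exact (edge_integrable g).continuousOn_mul
    (Complex.continuous_ofReal.comp hφ).continuousOn isCompact_Icc

/-- The primitive `x ↦ ∫₀ˣ φ g` on an edge. -/
def wprim (φ : ℝ → ℝ) (g : EdgeL2) (x : ℝ) : ℂ := ∫ t in (0 : ℝ)..x, (φ t : ℂ) * edgeExt g t

@[simp] lemma wprim_zero (φ : ℝ → ℝ) (g : EdgeL2) : wprim φ g 0 = 0 := by simp [wprim]

lemma continuous_wprim {φ : ℝ → ℝ} (hφ : Continuous φ) (g : EdgeL2) : Continuous (wprim φ g) :=
  intervalIntegral.continuous_primitive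
    (fun _ _ => (integrable_mul_edgeExt hφ g).intervalIntegrable) 0

lemma wprim_add {φ : ℝ → ℝ} (hφ : Continuous φ) (g g' : EdgeL2) (x : ℝ) :
    wprim φ (g + g') x = wprim φ g x + wprim φ g' x := by
  rw [wprim, wprim, wprim, ← intervalIntegral.integral_add
    (integrable_mul_edgeExt hφ g).intervalIntegrable
    (integrable_mul_edgeExt hφ g').intervalIntegrable]
  refine intervalIntegral.integral_congr_ae ?_
  filter_upwards [edgeExt_add g g'] with t ht _
  rw [ht, Pi.add_apply, mul_add]

lemma wprim_smul (φ : ℝ → ℝ) (c : ℂ) (g : EdgeL2) (x : ℝ) :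
    wprim φ (c • g) x = c * wprim φ g x := by
  rw [wprim, wprim, ← intervalIntegral.integral_const_mul]
  refine intervalIntegral.integral_congr_ae ?_
  filter_upwards [edgeExt_smul c g] with t ht _
  rw [ht, Pi.smul_apply, smul_eq_mul]
  ring

/-- Hölder's inequality on an interval of finite measure. -/
lemma exists_integral_norm_le : ∃ K : ℝ, 0 ≤ K ∧ ∀ g : EdgeL2,
    ∫ t in Icc (0 : ℝ) Real.pi, ‖g t‖ ≤ K * ‖g‖ := by
  set μ := volume.restrict (Icc (0 : ℝ) Real.pi) with hμ
  refine ⟨(μ univ ^ (1 / (1 : ENNReal).toReal - 1 / (2 : ENNReal).toReal)).toReal,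
    ENNReal.toReal_nonneg, fun g => ?_⟩
  have h := eLpNorm_le_eLpNorm_mul_rpow_measure_univ (μ := μ) (p := 1) (q := 2) (f := g)
    (by norm_num) (Lp.aestronglyMeasurable g)
  have hfin : μ univ ^ (1 / (1 : ENNReal).toReal - 1 / (2 : ENNReal).toReal) ≠ ⊤ :=
    ENNReal.rpow_ne_top_of_nonneg (by norm_num) (measure_ne_top μ _)
  have h2 := ENNReal.toReal_mono (ENNReal.mul_ne_top (Lp.eLpNorm_ne_top g) hfin) h
  rw [ENNReal.toReal_mul, ← Lp.norm_def, mul_comm] at h2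
  refine le_trans (le_of_eq ?_) h2
  rw [eLpNorm_one_eq_lintegral_enorm, ← integral_norm_eq_lintegral_enorm
    (Lp.aestronglyMeasurable g)]

lemma exists_wprim_le {φ : ℝ → ℝ} (hφ : Continuous φ) : ∃ K : ℝ, 0 ≤ K ∧ ∀ g : EdgeL2,
    ∀ x ∈ Icc (0 : ℝ) Real.pi, ‖wprim φ g x‖ ≤ K * ‖g‖ := by
  obtain ⟨K, hK0, hK⟩ := exists_integral_norm_le
  obtain ⟨M, hM⟩ := isCompact_Icc.exists_bound_of_continuousOn (s := Icc (0 : ℝ) Real.pi)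
    hφ.continuousOn
  have hM0 : 0 ≤ M := (norm_nonneg _).trans (hM 0 ⟨le_rfl, Real.pi_pos.le⟩)
  refine ⟨M * K, by positivity, fun g x hx => ?_⟩
  have hint := integrable_mul_edgeExt hφ g
  calc ‖wprim φ g x‖ ≤ ∫ t in (0 : ℝ)..x, M * ‖edgeExt g t‖ := by
        refine intervalIntegral.norm_integral_le_of_norm_le hx.1 (ae_of_all _ fun t ht => ?_)
          ((integrable_edgeExt g).norm.const_mul M).intervalIntegrable
        rw [norm_mul, Complex.norm_real]
        exact mul_le_mul_of_nonneg_right (hM t ⟨ht.1.le, ht.2.trans hx.2⟩) (norm_nonneg _)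
    _ = M * ∫ t in Ioc 0 x, ‖g t‖ := by
        rw [intervalIntegral.integral_const_mul, intervalIntegral.integral_of_le hx.1]
        congr 1
        refine setIntegral_congr_fun measurableSet_Ioc fun t ht => ?_
        simp only [edgeExt_of_mem g ⟨ht.1.le, ht.2.trans hx.2⟩]
    _ ≤ M * ∫ t in Icc (0 : ℝ) Real.pi, ‖g t‖ := by
        refine mul_le_mul_of_nonneg_left ?_ hM0
        exact setIntegral_mono_set (edge_integrable g).norm (ae_of_all _ fun t => norm_nonneg _)
          (ae_of_all _ fun t ht => ⟨ht.1.le, ht.2.trans hx.2⟩)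
    _ ≤ M * K * ‖g‖ := by
        rw [mul_assoc]
        exact mul_le_mul_of_nonneg_left (hK g) hM0

/-! ### Continuous functions as elements of L² of an edge. -/

lemma memLp_of_continuous {u : ℝ → ℂ} (hu : Continuous u) :
    MemLp u 2 (volume.restrict (Icc (0 : ℝ) Real.pi)) := by
  obtain ⟨M, hM⟩ := isCompact_Icc.exists_bound_of_continuousOn (s := Icc (0 : ℝ) Real.pi)
    hu.continuousOn
  exact MemLp.of_bound hu.aestronglyMeasurable M
    ((ae_restrict_iff' measurableSet_Icc).2 (ae_of_all _ hM))

/-- The element of `L²` of an edge given by a continuous function. -/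
def contL2 (u : ℝ → ℂ) (hu : Continuous u) : EdgeL2 := (memLp_of_continuous hu).toLp u

lemma coeFn_contL2 {u : ℝ → ℂ} (hu : Continuous u) :
    contL2 u hu =ᵐ[volume.restrict (Icc (0 : ℝ) Real.pi)] u :=
  (memLp_of_continuous hu).coeFn_toLp

lemma contL2_ext {u : ℝ → ℂ} (hu : Continuous u) {f : EdgeL2}
    (h : ∀ᵐ x ∂(volume.restrict (Icc (0 : ℝ) Real.pi)), f x = u x) : f = contL2 u hu := by
  refine Lp.ext ?_
  filter_upwards [h, coeFn_contL2 hu] with x h1 h2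
  rw [h1, h2]

/-- A pointwise bounded linear map into continuous functions is a bounded operator in `L²`. -/
lemma exists_clm_of_pointwise_bound (Φ : EdgeL2 → ℝ → ℂ) (hc : ∀ g, Continuous (Φ g))
    (hadd : ∀ g g' x, Φ (g + g') x = Φ g x + Φ g' x) (hsmul : ∀ (c : ℂ) g x, Φ (c • g) x = c * Φ g x)
    {K : ℝ} (hK0 : 0 ≤ K) (hK : ∀ g, ∀ x ∈ Icc (0 : ℝ) Real.pi, ‖Φ g x‖ ≤ K * ‖g‖) :
    ∃ T : EdgeL2 →L[ℂ] EdgeL2, ∀ g, T g = contL2 (Φ g) (hc g) := by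
  let T₀ : EdgeL2 →ₗ[ℂ] EdgeL2 :=
    { toFun := fun g => contL2 (Φ g) (hc g)
      map_add' := fun g g' => by
        refine (contL2_ext (hc (g + g')) ?_).symm
        filter_upwards [Lp.coeFn_add (contL2 (Φ g) (hc g)) (contL2 (Φ g') (hc g')),
          coeFn_contL2 (hc g), coeFn_contL2 (hc g')] with x h1 h2 h3
        rw [h1, Pi.add_apply, h2, h3, hadd]
      map_smul' := fun c g => by
        refine (contL2_ext (hc (c • g)) ?_).symm
        filter_upwards [Lp.coeFn_smul c (contL2 (Φ g) (hc g)), coeFn_contL2 (hc g)] with x h1 h2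
        rw [RingHom.id_apply, h1, Pi.smul_apply, h2, hsmul, smul_eq_mul] }
  refine ⟨T₀.mkContinuous (((volume.restrict (Icc (0 : ℝ) Real.pi)).real univ)
    ^ (2 : ENNReal).toReal⁻¹ * K) fun g => ?_, fun g => rfl⟩
  rw [mul_assoc]
  refine Lp.norm_le_of_ae_bound (by positivity) ?_
  filter_upwards [coeFn_contL2 (hc g), ae_restrict_mem measurableSet_Icc] with x h1 h2
  change ‖contL2 (Φ g) (hc g) x‖ ≤ _
  rw [h1]
  exact hK g x h2

lemma IsH2.of_continuous {u v w : ℝ → ℂ} (hu : Continuous u) (hw : Continuous w)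
    (h1 : ∀ x, HasDerivAt u (v x) x) (h2 : ∀ x, HasDerivAt v (w x) x) :
    IsH2 (contL2 u hu) (contL2 w hw) u v where
  ae_eq := coeFn_contL2 hu
  hasDeriv x _ := (h1 x).hasDerivWithinAt
  eq_integral x hx := by
    rw [edge_integral_congr (coeFn_contL2 hw) hx,
      intervalIntegral.integral_eq_sub_of_hasDerivAt (fun t _ => h2 t) (hw.intervalIntegrable _ _)]
    ring

/-- Once the weak second derivative has a continuous representative, the fundamental theorem of
calculus makes it classical. This gives regularity of solutions of the homogeneous equation. -/
lemma IsH2.hasDeriv_snd {f g : EdgeL2} {u v w : ℝ → ℂ} (h : IsH2 f g u v)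
    (hw : ContinuousOn w (Icc (0 : ℝ) Real.pi))
    (hg : g =ᵐ[volume.restrict (Icc (0 : ℝ) Real.pi)] w) :
    ∀ x ∈ Icc (0 : ℝ) Real.pi, HasDerivWithinAt v (w x) (Icc (0 : ℝ) Real.pi) x := by
  intro x hx
  -- Extending w by constants beyond the end points gives a two-sided derivative even at 0 and π.
  set w' : ℝ → ℂ := IccExtend Real.pi_pos.le ((Icc (0 : ℝ) Real.pi).domRestrict w) with hw'
  have hc : Continuous w' := (continuousOn_iff_continuous_domRestrict.1 hw).Icc_extend'
  have heq : ∀ t ∈ Icc (0 : ℝ) Real.pi, w' t = w t := fun t ht =>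
    IccExtend_of_mem Real.pi_pos.le _ ht
  have hd : HasDerivAt (fun y => v 0 + ∫ t in (0 : ℝ)..y, w' t) (w x) x := by
    rw [← heq x hx]
    exact (hc.integral_hasStrictDerivAt 0 x).hasDerivAt.const_add _
  refine hd.hasDerivWithinAt.congr_of_mem (fun y hy => ?_) hx
  rw [h.eq_integral y hy, edge_integral_congr hg hy]
  congr 1
  refine intervalIntegral.integral_congr fun t ht => ?_
  rw [uIcc_of_le hy.1] at ht
  exact (heq t ⟨ht.1, ht.2.trans hy.2⟩).symm

/-! ### The inhomogeneous equation `-u'' + κ² u = g` on one edge -/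

lemma hasDerivAt_cosh_mul (κ x : ℝ) :
    HasDerivAt (fun t => Real.cosh (κ * t)) (κ * Real.sinh (κ * x)) x := by
  have := ((hasDerivAt_id x).const_mul κ).cosh
  simpa [mul_comm] using this

lemma hasDerivAt_sinh_mul (κ x : ℝ) :
    HasDerivAt (fun t => Real.sinh (κ * t)) (κ * Real.cosh (κ * x)) x := by
  have := ((hasDerivAt_id x).const_mul κ).sinh
  simpa [mul_comm] using this

lemma continuous_cosh_mul (κ : ℝ) : Continuous (fun t => Real.cosh (κ * t)) := by fun_prop

lemma continuous_sinh_mul (κ : ℝ) : Continuous (fun t => Real.sinh (κ * t)) := by fun_prop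

/-- The solution of `-u'' + κ² u = g` with `u(0) = u'(0) = 0`. -/
def volterra (κ : ℝ) (g : EdgeL2) (x : ℝ) : ℂ :=
  (κ : ℂ)⁻¹ * ((Real.cosh (κ * x) : ℂ) * wprim (fun t => Real.sinh (κ * t)) g x
    - (Real.sinh (κ * x) : ℂ) * wprim (fun t => Real.cosh (κ * t)) g x)

/-- The derivative of `volterra κ g`. -/
def volterraDeriv (κ : ℝ) (g : EdgeL2) (x : ℝ) : ℂ :=
  (Real.sinh (κ * x) : ℂ) * wprim (fun t => Real.sinh (κ * t)) g x
    - (Real.cosh (κ * x) : ℂ) * wprim (fun t => Real.cosh (κ * t)) g x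

@[simp] lemma volterra_zero (κ : ℝ) (g : EdgeL2) : volterra κ g 0 = 0 := by simp [volterra]

@[simp] lemma volterraDeriv_zero (κ : ℝ) (g : EdgeL2) : volterraDeriv κ g 0 = 0 := by
  simp [volterraDeriv]

lemma continuous_volterra (κ : ℝ) (g : EdgeL2) : Continuous (volterra κ g) := by
  have h1 := continuous_wprim (continuous_sinh_mul κ) g
  have h2 := continuous_wprim (continuous_cosh_mul κ) g
  unfold volterra
  fun_prop

lemma continuous_volterraDeriv (κ : ℝ) (g : EdgeL2) : Continuous (volterraDeriv κ g) := by
  have h1 := continuous_wprim (continuous_sinh_mul κ) g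
  have h2 := continuous_wprim (continuous_cosh_mul κ) g
  unfold volterraDeriv
  fun_prop

lemma mul_wprim {φ φ' χ : ℝ → ℝ} (hφ : ∀ t, HasDerivAt φ (φ' t) t) (hφ' : Continuous φ')
    (hχ : Continuous χ) (g : EdgeL2) (x : ℝ) :
    (φ x : ℂ) * wprim χ g x =
      ∫ t in (0 : ℝ)..x, ((φ' t : ℂ) * wprim χ g t + (φ t : ℂ) * ((χ t : ℂ) * edgeExt g t)) :=
  mul_primitive_eq_integral (integrable_mul_edgeExt hχ g).intervalIntegrable hφ hφ'

lemma intervalIntegrable_mul_wprim {φ φ' χ : ℝ → ℝ} (hφ : ∀ t, HasDerivAt φ (φ' t) t)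
    (hφ' : Continuous φ') (hχ : Continuous χ) (g : EdgeL2) (x : ℝ) :
    IntervalIntegrable
      (fun t => (φ' t : ℂ) * wprim χ g t + (φ t : ℂ) * ((χ t : ℂ) * edgeExt g t)) volume 0 x := by
  have hφc : Continuous φ := continuous_iff_continuousAt.2 fun t => (hφ t).continuousAt
  have hw := continuous_wprim hχ g
  refine IntervalIntegrable.add (Continuous.intervalIntegrable (by fun_prop) _ _) ?_
  exact (integrable_mul_edgeExt hχ g).intervalIntegrable.continuousOn_mul
    (Complex.continuous_ofReal.comp hφc).continuousOn

/-- Variation of constants: under the product rule the two terms containing g cancel, as cosh · sinh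
- sinh · cosh = 0. -/
lemma volterra_eq_integral {κ : ℝ} (hκ : 0 < κ) (g : EdgeL2) (x : ℝ) :
    volterra κ g x = ∫ t in (0 : ℝ)..x, volterraDeriv κ g t := by
  have hκ' : (κ : ℂ) ≠ 0 := by exact_mod_cast hκ.ne'
  have hs := continuous_sinh_mul κ
  have hc := continuous_cosh_mul κ
  rw [volterra, mul_wprim (hasDerivAt_cosh_mul κ) (hs.const_mul κ) hs,
    mul_wprim (hasDerivAt_sinh_mul κ) (hc.const_mul κ) hc,
    ← intervalIntegral.integral_sub
      (intervalIntegrable_mul_wprim (hasDerivAt_cosh_mul κ) (hs.const_mul κ) hs g x)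
      (intervalIntegrable_mul_wprim (hasDerivAt_sinh_mul κ) (hc.const_mul κ) hc g x),
    ← intervalIntegral.integral_const_mul]
  refine intervalIntegral.integral_congr fun t _ => ?_
  simp only [volterraDeriv]
  push_cast
  field_simp
  ring

lemma hasDerivAt_volterra {κ : ℝ} (hκ : 0 < κ) (g : EdgeL2) (x : ℝ) :
    HasDerivAt (volterra κ g) (volterraDeriv κ g x) x := by
  rw [show volterra κ g = _ from funext (volterra_eq_integral hκ g)]
  exact ((continuous_volterraDeriv κ g).integral_hasStrictDerivAt 0 x).hasDerivAt

/-- Here the terms containing g have total coefficient sinh² - cosh² = -1. The identity stays in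
integral form because g is merely integrable. -/
lemma volterraDeriv_eq_integral {κ : ℝ} (hκ : 0 < κ) (g : EdgeL2) (x : ℝ) :
    volterraDeriv κ g x = ∫ t in (0 : ℝ)..x, ((κ : ℂ) ^ 2 * volterra κ g t - edgeExt g t) := by
  have hκ' : (κ : ℂ) ≠ 0 := by exact_mod_cast hκ.ne'
  have hs := continuous_sinh_mul κ
  have hc := continuous_cosh_mul κ
  rw [volterraDeriv, mul_wprim (hasDerivAt_sinh_mul κ) (hc.const_mul κ) hs,
    mul_wprim (hasDerivAt_cosh_mul κ) (hs.const_mul κ) hc,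
    ← intervalIntegral.integral_sub
      (intervalIntegrable_mul_wprim (hasDerivAt_sinh_mul κ) (hc.const_mul κ) hs g x)
      (intervalIntegrable_mul_wprim (hasDerivAt_cosh_mul κ) (hs.const_mul κ) hc g x)]
  refine intervalIntegral.integral_congr fun t _ => ?_
  have h : (Real.cosh (κ * t) : ℂ) ^ 2 = (Real.sinh (κ * t) : ℂ) ^ 2 + 1 := by
    exact_mod_cast Real.cosh_sq (κ * t)
  simp only [volterra]
  push_cast at h ⊢
  field_simp
  linear_combination (-(edgeExt g t)) * h

lemma isH2_volterra {κ : ℝ} (hκ : 0 < κ) (g : EdgeL2) :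
    IsH2 (contL2 _ (continuous_volterra κ g))
      ((κ : ℂ) ^ 2 • contL2 _ (continuous_volterra κ g) - g)
      (volterra κ g) (volterraDeriv κ g) where
  ae_eq := coeFn_contL2 _
  hasDeriv x _ := (hasDerivAt_volterra hκ g x).hasDerivWithinAt
  eq_integral x hx := by
    rw [volterraDeriv_zero, zero_add, volterraDeriv_eq_integral hκ]
    refine (edge_integral_congr ?_ hx).symm
    filter_upwards [Lp.coeFn_sub ((κ : ℂ) ^ 2 • contL2 _ (continuous_volterra κ g)) g,
      Lp.coeFn_smul ((κ : ℂ) ^ 2) (contL2 _ (continuous_volterra κ g)),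
      coeFn_contL2 (continuous_volterra κ g), ae_restrict_mem measurableSet_Icc]
      with t h1 h2 h3 h4
    rw [h1, Pi.sub_apply, h2, Pi.smul_apply, h3, edgeExt_of_mem g h4, smul_eq_mul]

lemma volterra_add (κ : ℝ) (g g' : EdgeL2) (x : ℝ) :
    volterra κ (g + g') x = volterra κ g x + volterra κ g' x := by
  simp only [volterra, wprim_add (continuous_sinh_mul κ), wprim_add (continuous_cosh_mul κ)]
  ring

lemma volterra_smul (κ : ℝ) (c : ℂ) (g : EdgeL2) (x : ℝ) :
    volterra κ (c • g) x = c * volterra κ g x := by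
  simp only [volterra, wprim_smul]
  ring

lemma volterraDeriv_add (κ : ℝ) (g g' : EdgeL2) (x : ℝ) :
    volterraDeriv κ (g + g') x = volterraDeriv κ g x + volterraDeriv κ g' x := by
  simp only [volterraDeriv, wprim_add (continuous_sinh_mul κ), wprim_add (continuous_cosh_mul κ)]
  ring

lemma volterraDeriv_smul (κ : ℝ) (c : ℂ) (g : EdgeL2) (x : ℝ) :
    volterraDeriv κ (c • g) x = c * volterraDeriv κ g x := by
  simp only [volterraDeriv, wprim_smul]
  ring

lemma exists_combination_le (a b : ℝ → ℂ) (ha : Continuous a) (hb : Continuous b)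
    {φ χ : ℝ → ℝ} (hφ : Continuous φ) (hχ : Continuous χ) :
    ∃ K : ℝ, 0 ≤ K ∧ ∀ g : EdgeL2, ∀ x ∈ Icc (0 : ℝ) Real.pi,
      ‖a x * wprim φ g x - b x * wprim χ g x‖ ≤ K * ‖g‖ := by
  obtain ⟨K, hK0, hK⟩ := exists_wprim_le hφ
  obtain ⟨K', hK0', hK'⟩ := exists_wprim_le hχ
  obtain ⟨A, hA⟩ := isCompact_Icc.exists_bound_of_continuousOn (s := Icc (0 : ℝ) Real.pi)
    ha.continuousOn
  obtain ⟨B, hB⟩ := isCompact_Icc.exists_bound_of_continuousOn (s := Icc (0 : ℝ) Real.pi)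
    hb.continuousOn
  have h0 : (0 : ℝ) ∈ Icc (0 : ℝ) Real.pi := ⟨le_rfl, Real.pi_pos.le⟩
  have hA0 := (norm_nonneg _).trans (hA 0 h0)
  have hB0 := (norm_nonneg _).trans (hB 0 h0)
  refine ⟨A * K + B * K', by positivity, fun g x hx => ?_⟩
  calc _ ≤ ‖a x‖ * ‖wprim φ g x‖ + ‖b x‖ * ‖wprim χ g x‖ := by
        rw [← norm_mul, ← norm_mul]; exact norm_sub_le _ _
    _ ≤ A * (K * ‖g‖) + B * (K' * ‖g‖) := by
        gcongr
        exacts [hA x hx, hK g x hx, hB x hx, hK' g x hx]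
    _ = _ := by ring

lemma exists_volterra_le (κ : ℝ) : ∃ K : ℝ, 0 ≤ K ∧ ∀ g : EdgeL2,
    ∀ x ∈ Icc (0 : ℝ) Real.pi, ‖volterra κ g x‖ ≤ K * ‖g‖ := by
  obtain ⟨K, hK0, hK⟩ := exists_combination_le
    (fun x => (κ : ℂ)⁻¹ * (Real.cosh (κ * x) : ℂ)) (fun x => (κ : ℂ)⁻¹ * (Real.sinh (κ * x) : ℂ))
    (by fun_prop) (by fun_prop) (continuous_sinh_mul κ) (continuous_cosh_mul κ)
  refine ⟨K, hK0, fun g x hx => ?_⟩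
  rw [volterra, mul_sub, ← mul_assoc, ← mul_assoc]
  exact hK g x hx

lemma exists_volterraDeriv_le (κ : ℝ) : ∃ K : ℝ, 0 ≤ K ∧ ∀ g : EdgeL2,
    ∀ x ∈ Icc (0 : ℝ) Real.pi, ‖volterraDeriv κ g x‖ ≤ K * ‖g‖ :=
  exists_combination_le (fun x => (Real.sinh (κ * x) : ℂ)) (fun x => (Real.cosh (κ * x) : ℂ))
    (by fun_prop) (by fun_prop) (continuous_sinh_mul κ) (continuous_cosh_mul κ)

lemma exists_volterra_clm (κ : ℝ) : ∃ V : EdgeL2 →L[ℂ] EdgeL2,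
    ∀ g, V g = contL2 _ (continuous_volterra κ g) := by
  obtain ⟨K, hK0, hK⟩ := exists_volterra_le κ
  exact exists_clm_of_pointwise_bound (volterra κ) (continuous_volterra κ)
    (volterra_add κ) (volterra_smul κ) hK0 hK

lemma exists_volterra_pi_clm (κ : ℝ) : ∃ p : EdgeL2 →L[ℂ] ℂ,
    ∀ g, p g = volterra κ g Real.pi := by
  obtain ⟨K, -, hK⟩ := exists_volterra_le κ
  exact ⟨LinearMap.mkContinuous
    { toFun := fun g => volterra κ g Real.pi
      map_add' := fun g g' => volterra_add κ g g' _
      map_smul' := fun c g => volterra_smul κ c g _ } K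
    fun g => hK g _ ⟨Real.pi_pos.le, le_rfl⟩, fun g => rfl⟩

lemma exists_volterraDeriv_pi_clm (κ : ℝ) : ∃ q : EdgeL2 →L[ℂ] ℂ,
    ∀ g, q g = volterraDeriv κ g Real.pi := by
  obtain ⟨K, -, hK⟩ := exists_volterraDeriv_le κ
  exact ⟨LinearMap.mkContinuous
    { toFun := fun g => volterraDeriv κ g Real.pi
      map_add' := fun g g' => volterraDeriv_add κ g g' _
      map_smul' := fun c g => volterraDeriv_smul κ c g _ } K
    fun g => hK g _ ⟨Real.pi_pos.le, le_rfl⟩, fun g => rfl⟩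

/-! ### The homogeneous equation `u'' = κ² u` on one edge -/

/-- The solution of `u'' = κ² u` with `u(0) = 1` and `u(π) = 0`. -/
def solL (κ x : ℝ) : ℂ :=
  (Real.cosh (κ * x) : ℂ) -
    (Real.cosh (κ * Real.pi) : ℂ) / (Real.sinh (κ * Real.pi) : ℂ) * (Real.sinh (κ * x) : ℂ)

/-- The derivative of `solL`. -/
def solLDeriv (κ x : ℝ) : ℂ :=
  (κ : ℂ) * ((Real.sinh (κ * x) : ℂ) -
    (Real.cosh (κ * Real.pi) : ℂ) / (Real.sinh (κ * Real.pi) : ℂ) * (Real.cosh (κ * x) : ℂ))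

/-- The solution of `u'' = κ² u` with `u(0) = 0` and `u(π) = 1`. -/
def solR (κ x : ℝ) : ℂ := (Real.sinh (κ * x) : ℂ) / (Real.sinh (κ * Real.pi) : ℂ)

/-- The derivative of `solR`. -/
def solRDeriv (κ x : ℝ) : ℂ := (κ : ℂ) * (Real.cosh (κ * x) : ℂ) / (Real.sinh (κ * Real.pi) : ℂ)

lemma hasDerivAt_cosh_ofReal (κ x : ℝ) :
    HasDerivAt (fun t : ℝ => (Real.cosh (κ * t) : ℂ)) ((κ : ℂ) * (Real.sinh (κ * x) : ℂ)) x := by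
  simpa using (hasDerivAt_cosh_mul κ x).ofReal_comp

lemma hasDerivAt_sinh_ofReal (κ x : ℝ) :
    HasDerivAt (fun t : ℝ => (Real.sinh (κ * t) : ℂ)) ((κ : ℂ) * (Real.cosh (κ * x) : ℂ)) x := by
  simpa using (hasDerivAt_sinh_mul κ x).ofReal_comp

lemma hasDerivAt_solL (κ x : ℝ) : HasDerivAt (solL κ) (solLDeriv κ x) x := by
  refine ((hasDerivAt_cosh_ofReal κ x).sub
    ((hasDerivAt_sinh_ofReal κ x).const_mul _)).congr_deriv ?_
  rw [solLDeriv]; ring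

lemma hasDerivAt_solLDeriv (κ x : ℝ) : HasDerivAt (solLDeriv κ) ((κ : ℂ) ^ 2 * solL κ x) x := by
  refine (((hasDerivAt_sinh_ofReal κ x).sub
    ((hasDerivAt_cosh_ofReal κ x).const_mul _)).const_mul (κ : ℂ)).congr_deriv ?_
  rw [solL]; ring

lemma hasDerivAt_solR (κ x : ℝ) : HasDerivAt (solR κ) (solRDeriv κ x) x :=
  (hasDerivAt_sinh_ofReal κ x).div_const _

lemma hasDerivAt_solRDeriv (κ x : ℝ) : HasDerivAt (solRDeriv κ) ((κ : ℂ) ^ 2 * solR κ x) x := by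
  refine (((hasDerivAt_cosh_ofReal κ x).const_mul (κ : ℂ)).div_const _).congr_deriv ?_
  rw [solR]; ring

lemma continuous_solL (κ : ℝ) : Continuous (solL κ) :=
  continuous_iff_continuousAt.2 fun x => (hasDerivAt_solL κ x).continuousAt

lemma continuous_solR (κ : ℝ) : Continuous (solR κ) :=
  continuous_iff_continuousAt.2 fun x => (hasDerivAt_solR κ x).continuousAt

lemma sinh_pi_ne_zero {κ : ℝ} (hκ : 0 < κ) : (Real.sinh (κ * Real.pi) : ℂ) ≠ 0 := by
  exact_mod_cast (Real.sinh_pos_iff.2 (mul_pos hκ Real.pi_pos)).ne'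

@[simp] lemma solL_zero (κ : ℝ) : solL κ 0 = 1 := by simp [solL]

@[simp] lemma solR_zero (κ : ℝ) : solR κ 0 = 0 := by simp [solR]

lemma solL_pi {κ : ℝ} (hκ : 0 < κ) : solL κ Real.pi = 0 := by
  have := sinh_pi_ne_zero hκ
  rw [solL]
  field_simp
  ring

lemma solR_pi {κ : ℝ} (hκ : 0 < κ) : solR κ Real.pi = 1 := div_self (sinh_pi_ne_zero hκ)

/-- `solL` as an element of `L²`. -/
def edgeL (κ : ℝ) : EdgeL2 := contL2 _ (continuous_solL κ)

/-- `solR` as an element of `L²`. -/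
def edgeR (κ : ℝ) : EdgeL2 := contL2 _ (continuous_solR κ)

lemma contL2_const_mul {u : ℝ → ℂ} (hu : Continuous u) (c : ℂ) (h : Continuous fun x => c * u x) :
    contL2 (fun x => c * u x) h = c • contL2 u hu := by
  refine (contL2_ext h ?_).symm
  filter_upwards [Lp.coeFn_smul c (contL2 u hu), coeFn_contL2 hu] with x h1 h2
  rw [h1, Pi.smul_apply, h2, smul_eq_mul]

lemma isH2_edgeL (κ : ℝ) :
    IsH2 (edgeL κ) ((κ : ℂ) ^ 2 • edgeL κ) (solL κ) (solLDeriv κ) := by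
  have hc : Continuous fun x => (κ : ℂ) ^ 2 * solL κ x := (continuous_solL κ).const_mul _
  rw [edgeL, ← contL2_const_mul (continuous_solL κ) _ hc]
  exact IsH2.of_continuous _ hc (hasDerivAt_solL κ) (hasDerivAt_solLDeriv κ)

lemma isH2_edgeR (κ : ℝ) :
    IsH2 (edgeR κ) ((κ : ℂ) ^ 2 • edgeR κ) (solR κ) (solRDeriv κ) := by
  have hc : Continuous fun x => (κ : ℂ) ^ 2 * solR κ x := (continuous_solR κ).const_mul _
  rw [edgeR, ← contL2_const_mul (continuous_solR κ) _ hc]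
  exact IsH2.of_continuous _ hc (hasDerivAt_solR κ) (hasDerivAt_solRDeriv κ)

lemma eqOn_const_of_hasDerivWithinAt_zero {f : ℝ → ℂ}
    (h : ∀ x ∈ Icc (0 : ℝ) Real.pi, HasDerivWithinAt f 0 (Icc (0 : ℝ) Real.pi) x) :
    ∀ x ∈ Icc (0 : ℝ) Real.pi, f x = f 0 :=
  constant_of_derivWithin_zero (fun x hx => (h x hx).differentiableWithinAt)
    fun x hx => (h x (Ico_subset_Icc_self hx)).derivWithin
      (uniqueDiffOn_Icc Real.pi_pos x (Ico_subset_Icc_self hx))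

/-- A solution of `u'' = κ² u` on an edge is determined by its boundary values. -/
lemma IsH2.eq_of_homogeneous {κ : ℝ} (hκ : 0 < κ) {f : EdgeL2} {u v : ℝ → ℂ}
    (h : IsH2 f ((κ : ℂ) ^ 2 • f) u v) : ∀ x ∈ Icc (0 : ℝ) Real.pi,
      u x = u 0 * solL κ x + u Real.pi * solR κ x ∧
      v x = u 0 * solLDeriv κ x + u Real.pi * solRDeriv κ x := by
  have hκ' : (κ : ℂ) ≠ 0 := by exact_mod_cast hκ.ne'
  have hS := sinh_pi_ne_zero hκ
  have hu := h.hasDeriv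
  have hv := h.hasDeriv_snd (w := fun x => (κ : ℂ) ^ 2 * u x)
    (continuousOn_const.mul fun x hx => (hu x hx).continuousWithinAt) (by
      filter_upwards [Lp.coeFn_smul ((κ : ℂ) ^ 2) f, h.ae_eq] with x h1 h2
      rw [h1, Pi.smul_apply, h2, smul_eq_mul])
  -- Two first integrals of u'' = κ²u. Being constant, they can be solved for u and v in terms of
  -- u(0) and v(0), the determinant being cosh² - sinh² = 1.
  have hA := eqOn_const_of_hasDerivWithinAt_zero
    (f := fun x : ℝ => (κ : ℂ) * (Real.cosh (κ * x) : ℂ) * u x - (Real.sinh (κ * x) : ℂ) * v x)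
    fun x hx => by
      refine ((((hasDerivAt_cosh_ofReal κ x).const_mul (κ : ℂ)).hasDerivWithinAt.mul
        (hu x hx)).sub ((hasDerivAt_sinh_ofReal κ x).hasDerivWithinAt.mul
        (hv x hx))).congr_deriv ?_
      ring
  have hB := eqOn_const_of_hasDerivWithinAt_zero
    (f := fun x : ℝ => (Real.cosh (κ * x) : ℂ) * v x - (κ : ℂ) * (Real.sinh (κ * x) : ℂ) * u x)
    fun x hx => by
      refine (((hasDerivAt_cosh_ofReal κ x).hasDerivWithinAt.mul (hv x hx)).sub
        (((hasDerivAt_sinh_ofReal κ x).const_mul (κ : ℂ)).hasDerivWithinAt.mul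
        (hu x hx))).congr_deriv ?_
      ring
  simp only [mul_zero, Real.cosh_zero, Real.sinh_zero, Complex.ofReal_one, Complex.ofReal_zero,
    mul_one, zero_mul, sub_zero, one_mul] at hA hB
  have hsq : ∀ x : ℝ, (Real.cosh (κ * x) : ℂ) ^ 2 = (Real.sinh (κ * x) : ℂ) ^ 2 + 1 := fun x => by
    exact_mod_cast Real.cosh_sq (κ * x)
  have hux : ∀ x ∈ Icc (0 : ℝ) Real.pi,
      (κ : ℂ) * u x = κ * (Real.cosh (κ * x) : ℂ) * u 0 + (Real.sinh (κ * x) : ℂ) * v 0 := by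
    intro x hx
    linear_combination (Real.cosh (κ * x) : ℂ) * hA x hx + (Real.sinh (κ * x) : ℂ) * hB x hx
      - (κ : ℂ) * u x * hsq x
  have hvx : ∀ x ∈ Icc (0 : ℝ) Real.pi,
      v x = κ * (Real.sinh (κ * x) : ℂ) * u 0 + (Real.cosh (κ * x) : ℂ) * v 0 := by
    intro x hx
    linear_combination (Real.cosh (κ * x) : ℂ) * hB x hx + (Real.sinh (κ * x) : ℂ) * hA x hx
      - v x * hsq x
  have hpi := hux Real.pi ⟨Real.pi_pos.le, le_rfl⟩
  have hv0 : v 0 = (κ : ℂ) * (u Real.pi - (Real.cosh (κ * Real.pi) : ℂ) * u 0)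
      / (Real.sinh (κ * Real.pi) : ℂ) := by
    rw [eq_div_iff hS]
    linear_combination -hpi
  intro x hx
  constructor
  · refine mul_left_cancel₀ hκ' ?_
    rw [hux x hx, hv0, solL, solR]
    field_simp
    ring
  · rw [hvx x hx, hv0, solLDeriv, solRDeriv]
    field_simp
    ring

lemma IsH2.eq_edge_of_homogeneous {κ : ℝ} (hκ : 0 < κ) {f : EdgeL2} {u v : ℝ → ℂ}
    (h : IsH2 f ((κ : ℂ) ^ 2 • f) u v) : f = u 0 • edgeL κ + u Real.pi • edgeR κ := by
  refine Lp.ext ?_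
  filter_upwards [h.ae_eq, Lp.coeFn_add (u 0 • edgeL κ) (u Real.pi • edgeR κ),
    Lp.coeFn_smul (u 0) (edgeL κ), Lp.coeFn_smul (u Real.pi) (edgeR κ),
    coeFn_contL2 (continuous_solL κ), coeFn_contL2 (continuous_solR κ),
    ae_restrict_mem measurableSet_Icc] with x h1 h2 h3 h4 h5 h6 h7
  rw [h1, h2, Pi.add_apply, h3, h4, Pi.smul_apply, Pi.smul_apply, edgeL, edgeR, h5, h6,
    smul_eq_mul, smul_eq_mul]
  exact (h.eq_of_homogeneous hκ x h7).1

lemma eqOn_of_contL2_eq_zero {u : ℝ → ℂ} (hu : Continuous u) (h : contL2 u hu = 0) :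
    EqOn u 0 (Icc (0 : ℝ) Real.pi) := by
  refine Measure.eqOn_Icc_of_ae_eq volume Real.pi_pos.ne ?_ hu.continuousOn continuousOn_const
  have h1 := coeFn_contL2 hu
  rw [h] at h1
  filter_upwards [h1, Lp.coeFn_zero ℂ 2 (volume.restrict (Icc (0 : ℝ) Real.pi))] with x h2 h3
  rw [← h2, h3]

/-- Boundary values of a solution of `u'' = κ² u` are controlled by its norm in `L²`. -/
lemma exists_boundary_le {κ : ℝ} (hκ : 0 < κ) : ∃ K : ℝ, 0 ≤ K ∧ ∀ a b : ℂ,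
    ‖a‖ ≤ K * ‖a • edgeL κ + b • edgeR κ‖ := by
  let Φ : ℂ × ℂ →ₗ[ℂ] EdgeL2 :=
    (LinearMap.fst ℂ ℂ ℂ).smulRight (edgeL κ) + (LinearMap.snd ℂ ℂ ℂ).smulRight (edgeR κ)
  have hΦ : ∀ z : ℂ × ℂ, Φ z = z.1 • edgeL κ + z.2 • edgeR κ := fun z => rfl
  -- An injective linear map from a finite-dimensional space is bounded below. Injectivity follows
  -- by evaluating the continuous representative at 0 and π.
  have hker : LinearMap.ker Φ = ⊥ := by
    refine (LinearMap.ker_eq_bot').2 fun z hz => ?_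
    have hc : Continuous fun x => z.1 * solL κ x + z.2 * solR κ x :=
      ((continuous_solL κ).const_mul _).add ((continuous_solR κ).const_mul _)
    have h0 : contL2 _ hc = 0 := by
      rw [← hz, hΦ]
      refine (contL2_ext hc ?_).symm
      filter_upwards [Lp.coeFn_add (z.1 • edgeL κ) (z.2 • edgeR κ),
        Lp.coeFn_smul z.1 (edgeL κ), Lp.coeFn_smul z.2 (edgeR κ),
        coeFn_contL2 (continuous_solL κ), coeFn_contL2 (continuous_solR κ)] with x h2 h3 h4 h5 h6
      rw [h2, Pi.add_apply, h3, h4, Pi.smul_apply, Pi.smul_apply, edgeL, edgeR, h5, h6,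
        smul_eq_mul, smul_eq_mul]
    have heq := eqOn_of_contL2_eq_zero hc h0
    have h1 := heq (⟨le_rfl, Real.pi_pos.le⟩ : (0 : ℝ) ∈ Icc (0 : ℝ) Real.pi)
    have h2 := heq (⟨Real.pi_pos.le, le_rfl⟩ : Real.pi ∈ Icc (0 : ℝ) Real.pi)
    simp only [solL_zero, solR_zero, Pi.zero_apply, mul_one, mul_zero, add_zero] at h1
    simp only [solL_pi hκ, solR_pi hκ, Pi.zero_apply, mul_one, mul_zero, zero_add] at h2
    exact Prod.ext h1 h2
  obtain ⟨K, -, hK⟩ := Φ.exists_antilipschitzWith hker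
  refine ⟨K, K.2, fun a b => ?_⟩
  have := hK.le_mul_dist (a, b) 0
  rw [map_zero, dist_zero_right, dist_zero_right, hΦ] at this
  exact (le_max_left _ _).trans this

/-! ### Operators between `ℓ²` spaces -/

section LpMap

variable {ι E F : Type*} [NormedAddCommGroup E] [NormedAddCommGroup F]

lemma two_toReal_pos : 0 < (2 : ENNReal).toReal := by norm_num

lemma memℓp_of_le {f : ι → F} (y : lp (fun _ : ι => E) 2) {K : ℝ} (hK : 0 ≤ K)
    (h : ∀ i, ‖f i‖ ≤ K * ‖y i‖) : Memℓp f 2 := by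
  refine memℓp_gen ?_
  refine Summable.of_nonneg_of_le (fun i => by positivity) (fun i => ?_)
    (((lp.memℓp y).summable two_toReal_pos).mul_left (K ^ (2 : ENNReal).toReal))
  rw [← Real.mul_rpow hK (norm_nonneg _)]
  exact Real.rpow_le_rpow (norm_nonneg _) (h i) two_toReal_pos.le

lemma lp_norm_le_of_le (f : lp (fun _ : ι => F) 2) (y : lp (fun _ : ι => E) 2) {K : ℝ}
    (hK : 0 ≤ K) (h : ∀ i, ‖f i‖ ≤ K * ‖y i‖) : ‖f‖ ≤ K * ‖y‖ := by
  refine lp.norm_le_of_tsum_le two_toReal_pos (by positivity) ?_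
  rw [Real.mul_rpow hK (norm_nonneg _), lp.norm_rpow_eq_tsum two_toReal_pos, ← tsum_mul_left]
  refine Summable.tsum_le_tsum (fun i => ?_) ((lp.memℓp f).summable two_toReal_pos)
    (((lp.memℓp y).summable two_toReal_pos).mul_left _)
  rw [← Real.mul_rpow hK (norm_nonneg _)]
  exact Real.rpow_le_rpow (norm_nonneg _) (h i) two_toReal_pos.le

variable [NormedSpace ℂ E] [NormedSpace ℂ F]

/-- The permutation of coordinates as a linear isometry of `ℓ²`. -/
def lpPerm (E : Type*) [NormedAddCommGroup E] [NormedSpace ℂ E] (σ : Equiv.Perm ι) :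
    lp (fun _ : ι => E) 2 →ₗᵢ[ℂ] lp (fun _ : ι => E) 2 where
  toFun y := ⟨fun i => y (σ i), memℓp_gen
    (((lp.memℓp y).summable two_toReal_pos).comp_injective σ.injective)⟩
  map_add' _ _ := rfl
  map_smul' _ _ := rfl
  norm_map' y := by
    rw [lp.norm_eq_tsum_rpow two_toReal_pos, lp.norm_eq_tsum_rpow two_toReal_pos]
    congr 1
    exact σ.tsum_eq (fun i => ‖y i‖ ^ (2 : ENNReal).toReal)

@[simp] lemma lpPerm_apply (σ : Equiv.Perm ι) (y : lp (fun _ : ι => E) 2) (i : ι) :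
    lpPerm E σ y i = y (σ i) := rfl

/-- The coordinatewise action of a bounded operator on `ℓ²`. -/
def lpMap (ι : Type*) (T : E →L[ℂ] F) : lp (fun _ : ι => E) 2 →L[ℂ] lp (fun _ : ι => F) 2 :=
  LinearMap.mkContinuous
    { toFun := fun y => (⟨fun i => T (y i), memℓp_of_le y (norm_nonneg T)
        fun i => T.le_opNorm (y i)⟩ : lp (fun _ : ι => F) 2)
      map_add' := fun y y' => lp.ext (funext fun i => map_add T (y i) (y' i))
      map_smul' := fun c y => lp.ext (funext fun i => map_smul T c (y i)) } ‖T‖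
    fun y => lp_norm_le_of_le _ y (norm_nonneg T) fun i => T.le_opNorm (y i)

lemma lpPerm_clm_norm_le (σ : Equiv.Perm ι) :
    ‖(lpPerm E σ).toContinuousLinearMap‖ ≤ 1 := (lpPerm E σ).norm_toContinuousLinearMap_le

end LpMap

/-! ### Vertex data -/

/-- Values attached to the edges, for instance the values at the left ends. -/
abbrev VertexData : Type := lp (fun _ : Edge => ℂ) 2

/-- The shift of the chain by one ring. -/
def shift : Equiv.Perm Edge := (Equiv.addRight (1 : ℤ)).prodCongr (Equiv.refl Bool)

/-- The exchange of the upper and the lower semicircles. -/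
def flip : Equiv.Perm Edge := (Equiv.refl ℤ).prodCongr Equiv.boolNot

@[simp] lemma flip_apply (n : ℤ) (b : Bool) : flip (n, b) = (n, !b) := rfl

/-- The sum of the values on the two neighbouring rings: the sum of the shift and its inverse. -/
def neighbourSum : VertexData →L[ℂ] VertexData :=
  (lpPerm ℂ shift).toContinuousLinearMap + (lpPerm ℂ shift.symm).toContinuousLinearMap

/-- The difference operator `a ↦ 2 D aₙ - aₙ₊₁ - aₙ₋₁`. -/
def diffOp (D : ℝ) : VertexData →L[ℂ] VertexData :=
  algebraMap ℂ (VertexData →L[ℂ] VertexData) (2 * D : ℂ) - neighbourSum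

lemma diffOp_apply (D : ℝ) (a : VertexData) (n : ℤ) (b : Bool) :
    diffOp D a (n, b) = 2 * D * a (n, b) - (a (n + 1, b) + a (n - 1, b)) := rfl

lemma norm_neighbourSum_le : ‖neighbourSum‖ ≤ 2 := by
  refine (norm_add_le _ _).trans ?_
  have h1 := lpPerm_clm_norm_le (E := ℂ) shift
  have h2 := lpPerm_clm_norm_le (E := ℂ) shift.symm
  linarith

/-- The scalar 2D exceeds in modulus the norm of `neighbourSum`, so it lies in its resolvent set. -/
lemma isUnit_diffOp {D : ℝ} (hD : 1 < |D|) : IsUnit (diffOp D) := by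
  have : Nontrivial VertexData :=
    ⟨⟨lp.single 2 (0, true) 1, 0, fun h => by
      have h1 := congrArg (fun f : VertexData => f (0, true)) h
      simp at h1⟩⟩
  refine _root_.spectrum.mem_resolventSet_of_norm_lt (𝕜 := ℂ) (a := neighbourSum) ?_
  refine norm_neighbourSum_le.trans_lt ?_
  rw [norm_mul, Complex.norm_real, Real.norm_eq_abs]
  norm_num
  linarith

lemma diffOp_flip (D : ℝ) (a : VertexData) :
    diffOp D (lpPerm ℂ flip a) = lpPerm ℂ flip (diffOp D a) := by
  refine lp.ext (funext fun ⟨n, b⟩ => ?_)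
  simp only [diffOp_apply, lpPerm_apply, flip_apply]

/-- For `|D| ≤ 1` the difference operator is not bounded below. -/
lemma not_diffOp_bounded_below {D : ℝ} (hD : |D| ≤ 1) (K : ℝ) :
    ¬ ∀ a : VertexData, lpPerm ℂ flip a = a → ‖a‖ ≤ K * ‖diffOp D a‖ := by
  intro hK
  -- With D = cos θ and ζ = exp(iθ), the bounded sequence ζⁿ solves the recurrence, as ζ + ζ⁻¹ = 2D.
  -- Cutting it off to N rings gives squared norm 2N.
  set ζ : ℂ := Complex.exp (Real.arccos D * Complex.I) with hζ
  have hζn : ‖ζ‖ = 1 := Complex.norm_exp_ofReal_mul_I _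
  have hζ0 : ζ ≠ 0 := Complex.exp_ne_zero _
  have hζD : ζ + ζ⁻¹ = 2 * D := by
    rw [hζ, ← Complex.exp_neg, ← neg_mul, ← Complex.two_cos, ← Complex.ofReal_cos,
      Real.cos_arccos (abs_le.1 hD).1 (abs_le.1 hD).2]
  have hζz : ∀ n : ℤ, ‖ζ ^ n‖ = 1 := fun n => by rw [norm_zpow, hζn, one_zpow]
  have key : ∀ N : ℕ, 2 * (N : ℝ) ≤ K ^ 2 * 128 := by
    intro N
    set s : Finset Edge := Finset.Ico (0 : ℤ) N ×ˢ Finset.univ with hs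
    set a : VertexData := ∑ e ∈ s, lp.single 2 e (ζ ^ e.1) with ha
    have hae : ∀ n b, a (n, b) = if 0 ≤ n ∧ n < N then ζ ^ n else 0 := by
      intro n b
      rw [ha, lp.coeFn_sum, Finset.sum_apply]
      simp only [lp.coeFn_single, Finset.sum_pi_single, hs, Finset.mem_product, Finset.mem_Ico,
        Finset.mem_univ, and_true]
    have hnorm : ‖a‖ ^ 2 = 2 * N := by
      have := lp.norm_sum_single two_toReal_pos (fun e : Edge => ζ ^ e.1) s
      rw [← ha] at this
      simp only [hζz, ENNReal.toReal_ofNat, Real.rpow_two, one_pow, Finset.sum_const, hs,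
        Finset.card_product, Int.card_Ico, Finset.card_univ, Fintype.card_bool] at this
      rw [this]
      simp [mul_comm]
    have hflip : lpPerm ℂ flip a = a := by
      refine lp.ext (funext fun ⟨n, b⟩ => ?_)
      rw [lpPerm_apply, flip_apply, hae, hae]
    -- The defect lives only on rings next to the two cuts: at most 8 edges, with values at most 4,
    -- hence squared norm at most 8 · 16 = 128 independently of N.
    set t : Finset Edge := {-1, 0, (N : ℤ) - 1, (N : ℤ)} ×ˢ Finset.univ with ht
    have hzero : ∀ e ∉ t, diffOp D a e = 0 := by
      rintro ⟨n, b⟩ he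
      simp only [ht, Finset.mem_product, Finset.mem_insert, Finset.mem_singleton, Finset.mem_univ,
        and_true, not_or] at he
      rw [diffOp_apply, hae, hae, hae]
      by_cases h : 0 ≤ n ∧ n < N
      · rw [if_pos h, if_pos (by omega), if_pos (by omega), zpow_add_one₀ hζ0, zpow_sub_one₀ hζ0]
        linear_combination (-ζ ^ n) * hζD
      · rw [if_neg h, if_neg (by omega), if_neg (by omega)]
        simp
    have hbound : ∀ e, ‖diffOp D a e‖ ≤ 4 := by
      rintro ⟨n, b⟩
      have h1 : ∀ m, ‖a (m, b)‖ ≤ 1 := fun m => by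
        rw [hae]
        split_ifs
        · exact (hζz m).le
        · simp
      rw [diffOp_apply]
      calc _ ≤ ‖2 * (D : ℂ) * a (n, b)‖ + (‖a (n + 1, b)‖ + ‖a (n - 1, b)‖) :=
            (norm_sub_le _ _).trans (add_le_add_right (norm_add_le _ _) _)
        _ ≤ 2 * 1 * 1 + (1 + 1) := by
            rw [norm_mul, norm_mul, Complex.norm_real, Real.norm_eq_abs, Complex.norm_ofNat]
            gcongr
            exacts [h1 _, h1 _, h1 _]
        _ = 4 := by norm_num
    have hdiff : ‖diffOp D a‖ ^ 2 ≤ 128 := by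
      have h1 := lp.norm_rpow_eq_tsum two_toReal_pos (diffOp D a)
      simp only [ENNReal.toReal_ofNat, Real.rpow_two] at h1
      rw [h1, tsum_eq_sum (s := t) fun e he => by rw [hzero e he]; simp]
      calc ∑ e ∈ t, ‖diffOp D a e‖ ^ 2 ≤ ∑ e ∈ t, (4 : ℝ) ^ 2 :=
            Finset.sum_le_sum fun e _ => pow_le_pow_left₀ (norm_nonneg _) (hbound e) 2
        _ = t.card * 16 := by rw [Finset.sum_const, nsmul_eq_mul]; norm_num
        _ ≤ 8 * 16 := by
            gcongr
            have h4 : t.card ≤ 4 * 2 := by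
              rw [ht, Finset.card_product]
              exact Nat.mul_le_mul Finset.card_le_four (by simp)
            exact_mod_cast h4
        _ = 128 := by norm_num
    calc 2 * (N : ℝ) = ‖a‖ ^ 2 := hnorm.symm
      _ ≤ (K * ‖diffOp D a‖) ^ 2 := pow_le_pow_left₀ (norm_nonneg _) (hK a hflip) 2
      _ = K ^ 2 * ‖diffOp D a‖ ^ 2 := by ring
      _ ≤ K ^ 2 * 128 := by gcongr
  obtain ⟨N, hN⟩ := exists_nat_gt (K ^ 2 * 128)
  have := key N
  have h0 : (0 : ℝ) ≤ N := Nat.cast_nonneg N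
  linarith

/-! ### The Hamiltonian -/

lemma exists_hamiltonian_eq {α : EReal} {x y : StateSpace} (h : (x, y) ∈ hamiltonianGraph α) :
    ∃ hx : x ∈ (hamiltonian α).domain, hamiltonian α ⟨x, hx⟩ = y := by
  rw [← graph_hamiltonian, LinearPMap.mem_graph_iff] at h
  obtain ⟨z, hz, hy⟩ := h
  obtain ⟨z, hzd⟩ := z
  simp only at hz hy
  subst hz
  exact ⟨hzd, hy⟩

lemma mem_hamiltonianGraph {α : EReal} (x : (hamiltonian α).domain) :
    ((x : StateSpace), hamiltonian α x) ∈ hamiltonianGraph α := by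
  rw [← graph_hamiltonian]
  exact (hamiltonian α).mem_graph x

/-- Half the trace of the monodromy matrix of one ring, for functions even under `flip`. -/
def discriminant (r κ : ℝ) : ℝ :=
  Real.cosh (κ * Real.pi) + r / 4 * (Real.sinh (κ * Real.pi) / κ)

lemma solLDeriv_zero (κ : ℝ) :
    solLDeriv κ 0 = -((κ : ℂ) * Real.cosh (κ * Real.pi) / Real.sinh (κ * Real.pi)) := by
  simp [solLDeriv, mul_div_assoc]

lemma solRDeriv_zero (κ : ℝ) : solRDeriv κ 0 = (κ : ℂ) / Real.sinh (κ * Real.pi) := by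
  simp [solRDeriv]

lemma solLDeriv_pi {κ : ℝ} (hκ : 0 < κ) :
    solLDeriv κ Real.pi = -((κ : ℂ) / Real.sinh (κ * Real.pi)) := by
  have hS := sinh_pi_ne_zero hκ
  have hsq : (Real.cosh (κ * Real.pi) : ℂ) ^ 2 = (Real.sinh (κ * Real.pi) : ℂ) ^ 2 + 1 := by
    exact_mod_cast Real.cosh_sq (κ * Real.pi)
  rw [solLDeriv]
  field_simp
  linear_combination (-(κ : ℂ)) * hsq

/-- The `δ`-coupling as a difference equation for the values `a` at the vertices. The functions
`up` are particular solutions on the edges with vanishing initial data. -/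
lemma deltaCoupling_of_recurrence {r κ : ℝ} (hκ : 0 < κ) {up vp : Edge → ℝ → ℂ}
    (hup : ∀ e, up e 0 = 0) (hvp : ∀ e, vp e 0 = 0) (a : ℤ → ℂ) (n : ℤ)
    (h : 2 * (discriminant r κ : ℂ) * a n - (a (n + 1) + a (n - 1)) =
      -(1 / 2) * ∑ b : Bool, (up (n, b) Real.pi
        + (Real.sinh (κ * Real.pi) : ℂ) / κ * vp (n - 1, b) Real.pi
        - (Real.cosh (κ * Real.pi) : ℂ) * up (n - 1, b) Real.pi)) :
    DeltaCoupling (r : EReal)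
      (fun e x => up e x + a e.1 * solL κ x + (a (e.1 + 1) - up e Real.pi) * solR κ x)
      (fun e x => vp e x + a e.1 * solLDeriv κ x + (a (e.1 + 1) - up e Real.pi) * solRDeriv κ x)
      n := by
  have hS := sinh_pi_ne_zero hκ
  have hκ' : (κ : ℂ) ≠ 0 := by exact_mod_cast hκ.ne'
  have hD : (discriminant r κ : ℂ) = (Real.cosh (κ * Real.pi) : ℂ)
      + r / 4 * ((Real.sinh (κ * Real.pi) : ℂ) / κ) := by
    rw [discriminant]; push_cast; rfl
  refine ⟨a n, fun b => ?_, fun b => ?_, ?_⟩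
  · simp only [solL_pi hκ, solR_pi hκ, sub_add_cancel]
    ring
  · simp [hup]
  -- Multiplying the flux condition by -sinh κπ / (2κ) turns it into the assumed recurrence.
  · rw [if_neg (EReal.coe_ne_top r), EReal.toReal_coe]
    simp only [Fintype.sum_bool, hvp, solLDeriv_zero, solRDeriv_zero, solLDeriv_pi hκ,
      sub_add_cancel, zero_add] at h ⊢
    rw [solRDeriv]
    rw [hD] at h
    generalize (Real.sinh (κ * Real.pi) : ℂ) = S at *
    generalize (Real.cosh (κ * Real.pi) : ℂ) = C at *
    field_simp at h ⊢
    linear_combination (-1 / 4) * h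

/-- Vertex values of a solution of `-ψ'' = -κ² ψ` satisfy the homogeneous difference equation. -/
lemma recurrence_of_deltaCoupling {r κ : ℝ} (hκ : 0 < κ) {u v : Edge → ℝ → ℂ}
    (hv0 : ∀ e, v e 0 = u e 0 * solLDeriv κ 0 + u e Real.pi * solRDeriv κ 0)
    (hvpi : ∀ e, v e Real.pi = u e 0 * solLDeriv κ Real.pi + u e Real.pi * solRDeriv κ Real.pi)
    (h : ∀ n, DeltaCoupling (r : EReal) u v n) (n : ℤ) (b : Bool) :
    2 * (discriminant r κ : ℂ) * u (n, b) 0 - (u (n + 1, b) 0 + u (n - 1, b) 0) = 0 := by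
  have hS := sinh_pi_ne_zero hκ
  have hκ' : (κ : ℂ) ≠ 0 := by exact_mod_cast hκ.ne'
  have hD : (discriminant r κ : ℂ) = (Real.cosh (κ * Real.pi) : ℂ)
      + r / 4 * ((Real.sinh (κ * Real.pi) : ℂ) / κ) := by
    rw [discriminant]; push_cast; rfl
  obtain ⟨c, h1, h2, h3⟩ := h n
  obtain ⟨cp, hp1, hp2, -⟩ := h (n + 1)
  obtain ⟨cm, -, hm2, -⟩ := h (n - 1)
  rw [add_sub_cancel_right] at hp1
  rw [if_neg (EReal.coe_ne_top r), EReal.toReal_coe] at h3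
  simp only [Fintype.sum_bool, hv0, hvpi, h1, h2, hp1, hm2, solLDeriv_zero, solRDeriv_zero,
    solLDeriv_pi hκ] at h3
  rw [solRDeriv] at h3
  rw [hp2, h2, hm2, hD]
  generalize (Real.sinh (κ * Real.pi) : ℂ) = S at *
  generalize (Real.cosh (κ * Real.pi) : ℂ) = C at *
  field_simp at h3 ⊢
  linear_combination (-2) * h3

/-- Solutions of the homogeneous equation on all edges: the left boundary values are square
summable and determine the function. -/
lemma exists_vertexData {α : EReal} {κ : ℝ} (hκ : 0 < κ) {ψ : StateSpace} {u v : Edge → ℝ → ℂ}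
    (hH : ∀ e, IsH2 (ψ e) ((κ : ℂ) ^ 2 • ψ e) (u e) (v e))
    (hc : ∀ n, DeltaCoupling α u v n) :
    ∃ a : VertexData, (∀ e, a e = u e 0) ∧ (a = 0 → ψ = 0) := by
  obtain ⟨K, hK0, hK⟩ := exists_boundary_le hκ
  have heq : ∀ e, ψ e = u e 0 • edgeL κ + u e Real.pi • edgeR κ := fun e =>
    (hH e).eq_edge_of_homogeneous hκ
  refine ⟨⟨fun e => u e 0, memℓp_of_le ψ hK0 fun e => ?_⟩, fun e => rfl, fun h0 => ?_⟩
  · rw [heq e]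
    exact hK _ _
  · have h0' : ∀ e, u e 0 = 0 := fun e => congrArg (fun a : VertexData => a e) h0
    refine lp.ext (funext fun ⟨n, b⟩ => ?_)
    obtain ⟨c, h1, h2, -⟩ := hc (n + 1)
    have hpi : u (n, b) Real.pi = 0 := by
      have h3 := h1 b
      rw [add_sub_cancel_right] at h3
      rw [h3, ← h2 b, h0']
    rw [heq, h0', hpi, zero_smul, zero_smul, add_zero]
    rfl

/-! ### Points outside the spectrum: trivial kernel and explicit resolvent. -/

lemma IsH2.congr_deriv {f g g' : EdgeL2} {u v : ℝ → ℂ} (h : IsH2 f g u v) (hg : g = g') :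
    IsH2 f g' u v := hg ▸ h

/-- The vertex values of an eigenfunction vanish, either by the Dirichlet condition or because they
form an ℓ² element of the kernel of the invertible `diffOp`. They determine the function. -/
lemma eq_zero_of_graph {α : EReal} {κ : ℝ} (hκ : 0 < κ)
    (hα : α = ⊤ ∨ ∃ r : ℝ, α = r ∧ 1 < |discriminant r κ|) {ψ : StateSpace}
    (h : (ψ, -((κ : ℂ) ^ 2) • ψ) ∈ hamiltonianGraph α) : ψ = 0 := by
  obtain ⟨u, v, hH, hc⟩ := h
  have hH' : ∀ e, IsH2 (ψ e) ((κ : ℂ) ^ 2 • ψ e) (u e) (v e) := fun e => by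
    refine (hH e).congr_deriv ?_
    change -(-((κ : ℂ) ^ 2) • ψ e) = _
    module
  obtain ⟨a, ha, ha0⟩ := exists_vertexData hκ hH' hc
  refine ha0 ?_
  rcases hα with rfl | ⟨r, rfl, hD⟩
  · refine lp.ext (funext fun ⟨n, b⟩ => ?_)
    obtain ⟨c, -, h2, h3⟩ := hc n
    rw [if_pos rfl] at h3
    rw [ha, h2 b, h3]
    rfl
  · have hrec := recurrence_of_deltaCoupling hκ
      (fun e => ((hH' e).eq_of_homogeneous hκ 0 ⟨le_rfl, Real.pi_pos.le⟩).2)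
      (fun e => ((hH' e).eq_of_homogeneous hκ Real.pi ⟨Real.pi_pos.le, le_rfl⟩).2) hc
    have hL : diffOp (discriminant r κ) a = 0 := by
      refine lp.ext (funext fun ⟨n, b⟩ => ?_)
      rw [diffOp_apply, ha, ha, ha]
      exact hrec n b
    obtain ⟨N, hN⟩ := (isUnit_diffOp hD).exists_left_inv
    have := congrArg (fun T : VertexData →L[ℂ] VertexData => T a) hN
    simpa [hL] using this.symm

/-- Vertex values that turn the particular solutions on the edges into a function satisfying the
coupling conditions give the resolvent. -/
lemma notMem_spectrum_of_vertex_operator {α : EReal} {κ : ℝ} (hκ : 0 < κ)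
    (A : StateSpace →L[ℂ] VertexData)
    (hA : ∀ y n, DeltaCoupling α
      (fun e x => volterra κ (y e) x + A y e * solL κ x
        + (A y (shift e) - volterra κ (y e) Real.pi) * solR κ x)
      (fun e x => volterraDeriv κ (y e) x + A y e * solLDeriv κ x
        + (A y (shift e) - volterra κ (y e) Real.pi) * solRDeriv κ x) n)
    (hinj : ∀ ψ : StateSpace, (ψ, -((κ : ℂ) ^ 2) • ψ) ∈ hamiltonianGraph α → ψ = 0) :
    -((κ : ℂ) ^ 2) ∉ spectrum (hamiltonian α) := by
  obtain ⟨V, hV⟩ := exists_volterra_clm κ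
  obtain ⟨p, hp⟩ := exists_volterra_pi_clm κ
  -- Particular solution plus homogeneous corrections: the left end gets the value A y e, and the
  -- right end that of the next ring, after removing the end value of the particular solution.
  let R : StateSpace →L[ℂ] StateSpace :=
    lpMap Edge V
      + (lpMap Edge ((ContinuousLinearMap.id ℂ ℂ).smulRight (edgeL κ))).comp A
      + (lpMap Edge ((ContinuousLinearMap.id ℂ ℂ).smulRight (edgeR κ))).comp
        ((lpPerm ℂ shift).toContinuousLinearMap.comp A - lpMap Edge p)
  have hR : ∀ y e, R y e = contL2 _ (continuous_volterra κ (y e)) + A y e • edgeL κ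
      + (A y (shift e) - volterra κ (y e) Real.pi) • edgeR κ := by
    intro y e
    rw [← hV, ← hp]
    rfl
  have hgraph : ∀ y, (R y, y - ((κ : ℂ) ^ 2) • R y) ∈ hamiltonianGraph α := by
    intro y
    refine ⟨_, _, fun e => ?_, hA y⟩
    have h := ((isH2_volterra hκ (y e)).add ((isH2_edgeL κ).smul (A y e))).add
      ((isH2_edgeR κ).smul (A y (shift e) - volterra κ (y e) Real.pi))
    rw [← hR] at h
    refine h.congr_deriv ?_
    simp only [lp.coeFn_sub, lp.coeFn_smul, Pi.sub_apply, Pi.smul_apply, hR]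
    module
  have hright : ∀ y : StateSpace, ∃ h : R y ∈ (hamiltonian α).domain,
      hamiltonian α ⟨R y, h⟩ - (-((κ : ℂ) ^ 2)) • R y = y := by
    intro y
    obtain ⟨h, hy⟩ := exists_hamiltonian_eq (hgraph y)
    refine ⟨h, ?_⟩
    rw [hy]
    module
  intro hz
  refine hz ⟨R, hright, fun x => ?_⟩
  refine (sub_eq_zero.1 (hinj _ ?_))
  -- The left inverse property comes from injectivity: R(H₀ + κ²)x - x is annihilated by H₀ + κ².
  have h1 := hgraph (hamiltonian α x - (-((κ : ℂ) ^ 2)) • (x : StateSpace))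
  have h2 := (hamiltonianGraph α).sub_mem h1 (mem_hamiltonianGraph x)
  convert h2 using 1
  rw [Prod.mk_sub_mk]
  congr 1
  module

lemma notMem_spectrum_top {κ : ℝ} (hκ : 0 < κ) :
    -((κ : ℂ) ^ 2) ∉ spectrum (hamiltonian ⊤) := by
  refine notMem_spectrum_of_vertex_operator hκ 0 (fun y n => ?_)
    fun ψ hψ => eq_zero_of_graph hκ (Or.inl rfl) hψ
  refine ⟨0, fun b => ?_, fun b => ?_, by rw [if_pos rfl]⟩
  · simp [solL_pi hκ, solR_pi hκ]
  · simp

lemma notMem_spectrum_of_one_lt {r κ : ℝ} (hκ : 0 < κ) (hD : 1 < |discriminant r κ|) :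
    -((κ : ℂ) ^ 2) ∉ spectrum (hamiltonian r) := by
  obtain ⟨p, hp⟩ := exists_volterra_pi_clm κ
  obtain ⟨q, hq⟩ := exists_volterraDeriv_pi_clm κ
  obtain ⟨N, hN⟩ := (isUnit_diffOp hD).exists_right_inv
  obtain ⟨N', hN'⟩ := (isUnit_diffOp hD).exists_left_inv
  let S : ℂ := Real.sinh (κ * Real.pi)
  let C : ℂ := Real.cosh (κ * Real.pi)
  -- The right-hand side of the recurrence as a bounded operator of y. Composing with identity plus
  -- `flip` sums over both semicircles, so the output is `flip`-even.
  let B : StateSpace →L[ℂ] VertexData :=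
    ((-(1 / 2) : ℂ) • (lpMap Edge p + (lpPerm ℂ shift.symm).toContinuousLinearMap.comp
      (lpMap Edge ((S / κ) • q - C • p)))).comp
    (ContinuousLinearMap.id ℂ StateSpace + (lpPerm EdgeL2 flip).toContinuousLinearMap)
  have hB : ∀ y n b, B y (n, b) = -(1 / 2) * ((p (y (n, b)) + p (y (n, !b)))
      + (S / κ * (q (y (n - 1, b)) + q (y (n - 1, !b)))
        - C * (p (y (n - 1, b)) + p (y (n - 1, !b))))) := by
    intro y n b
    rw [← map_add, ← map_add, ← map_add]
    rfl
  have hL : ∀ y, diffOp (discriminant r κ) (N (B y)) = B y := fun y =>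
    congrArg (fun T : VertexData →L[ℂ] VertexData => T (B y)) hN
  have hflipB : ∀ y, lpPerm ℂ flip (B y) = B y := fun y => by
    refine lp.ext (funext fun ⟨n, b⟩ => ?_)
    rw [lpPerm_apply, flip_apply, hB, hB, Bool.not_not]
    ring
  -- `diffOp` commutes with `flip` and is injective, so the solution inherits the symmetry of the
  -- data. Both edges thus carry the same vertex values, as continuity demands.
  have hflip : ∀ y, lpPerm ℂ flip (N (B y)) = N (B y) := fun y => by
    have h1 : diffOp (discriminant r κ) (lpPerm ℂ flip (N (B y))) =
        diffOp (discriminant r κ) (N (B y)) := by rw [diffOp_flip, hL, hflipB]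
    have h2 := congrArg N' h1
    have h3 : ∀ a, N' (diffOp (discriminant r κ) a) = a := fun a =>
      congrArg (fun T : VertexData →L[ℂ] VertexData => T a) hN'
    rwa [h3, h3] at h2
  refine notMem_spectrum_of_vertex_operator hκ (N.comp B) (fun y n => ?_)
    fun ψ hψ => eq_zero_of_graph hκ (Or.inr ⟨r, rfl, hD⟩) hψ
  set a : ℤ → ℂ := fun n => N (B y) (n, true) with ha
  have hab : ∀ e, N (B y) e = a e.1 := by
    rintro ⟨n, _ | _⟩
    · exact congrArg (fun f : VertexData => f (n, true)) (hflip y)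
    · rfl
  have hrec := congrArg (fun f : VertexData => f (n, true)) (hL y)
  simp only [diffOp_apply, hB, hab, hp, hq, Bool.not_true] at hrec
  have := deltaCoupling_of_recurrence (r := r) hκ
    (up := fun e => volterra κ (y e)) (vp := fun e => volterraDeriv κ (y e))
    (fun e => volterra_zero κ _) (fun e => volterraDeriv_zero κ _) a n (by
      rw [hrec, Fintype.sum_bool]
      ring)
  simp only [ContinuousLinearMap.comp_apply, hab]
  exact this

/-! ### Almost solutions in the spectral bands -/

/-- A cubic polynomial vanishing with its derivative at `0`, vanishing at `π`, and of slope `1`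
at `π`. -/
def bump (x : ℝ) : ℂ := ((x ^ 3 - Real.pi * x ^ 2) / Real.pi ^ 2 : ℝ)

/-- The derivative of `bump`. -/
def bumpDeriv (x : ℝ) : ℂ := ((3 * x ^ 2 - 2 * Real.pi * x) / Real.pi ^ 2 : ℝ)

/-- The second derivative of `bump`. -/
def bumpDeriv₂ (x : ℝ) : ℂ := ((6 * x - 2 * Real.pi) / Real.pi ^ 2 : ℝ)

lemma continuous_bump : Continuous bump := by unfold bump; fun_prop

lemma continuous_bumpDeriv₂ : Continuous bumpDeriv₂ := by unfold bumpDeriv₂; fun_prop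

lemma hasDerivAt_bump (x : ℝ) : HasDerivAt bump (bumpDeriv x) x := by
  refine HasDerivAt.ofReal_comp (f := fun x => (x ^ 3 - Real.pi * x ^ 2) / Real.pi ^ 2) ?_
  refine (((hasDerivAt_pow 3 x).sub ((hasDerivAt_pow 2 x).const_mul Real.pi)).div_const
    (Real.pi ^ 2)).congr_deriv ?_
  norm_num
  ring

lemma hasDerivAt_bumpDeriv (x : ℝ) : HasDerivAt bumpDeriv (bumpDeriv₂ x) x := by
  refine HasDerivAt.ofReal_comp (f := fun x => (3 * x ^ 2 - 2 * Real.pi * x) / Real.pi ^ 2) ?_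
  refine ((((hasDerivAt_pow 2 x).const_mul 3).sub
    ((hasDerivAt_id x).const_mul (2 * Real.pi))).div_const (Real.pi ^ 2)).congr_deriv ?_
  norm_num
  ring

lemma bump_zero : bump 0 = 0 := by simp [bump]

lemma bumpDeriv_zero : bumpDeriv 0 = 0 := by simp [bumpDeriv]

lemma bump_pi : bump Real.pi = 0 := by
  rw [bump, show Real.pi ^ 3 - Real.pi * Real.pi ^ 2 = 0 by ring]; simp

lemma bumpDeriv_pi : bumpDeriv Real.pi = 1 := by
  have := Real.pi_ne_zero
  rw [bumpDeriv, show 3 * Real.pi ^ 2 - 2 * Real.pi * Real.pi = Real.pi ^ 2 by ring,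
    div_self (by positivity), Complex.ofReal_one]

/-- `bump` as an element of `L²`. -/
def edgeBump : EdgeL2 := contL2 _ continuous_bump

/-- The second derivative of `bump` as an element of `L²`. -/
def edgeBumpDeriv₂ : EdgeL2 := contL2 _ continuous_bumpDeriv₂

lemma isH2_edgeBump : IsH2 edgeBump edgeBumpDeriv₂ bump bumpDeriv :=
  IsH2.of_continuous _ _ hasDerivAt_bump hasDerivAt_bumpDeriv

/-- Only R(H₀ + κ²) = 1 on the domain is needed: it would make `diffOp` bounded below on `flip`-even
data. -/
lemma mem_spectrum_of_le_one {r κ : ℝ} (hκ : 0 < κ) (hD : |discriminant r κ| ≤ 1) :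
    -((κ : ℂ) ^ 2) ∈ spectrum (hamiltonian r) := by
  rintro ⟨R, -, hR⟩
  have hS := sinh_pi_ne_zero hκ
  have hκ' : (κ : ℂ) ≠ 0 := by exact_mod_cast hκ.ne'
  obtain ⟨K, hK0, hK⟩ := exists_boundary_le hκ
  -- The bump has end value 0 and end slope 1, so it enters the recurrence at vertex n only through
  -- its slope on ring n - 1. Balancing the recurrence there forces the amplitude s · (`diffOp` a)ₙ
  -- on ring n - 1, whence the shift in t.
  set s : ℂ := -((κ : ℂ) / Real.sinh (κ * Real.pi)) with hs
  let P : EdgeL2 → (VertexData →L[ℂ] StateSpace) := fun f =>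
    lpMap Edge ((ContinuousLinearMap.id ℂ ℂ).smulRight f)
  have hP : ∀ f a e, P f a e = a e • f := fun f a e => rfl
  let Q : VertexData →L[ℂ] VertexData := (lpPerm ℂ shift).toContinuousLinearMap
  have hQ : ∀ a, ‖Q a‖ ≤ ‖a‖ := fun a => ((lpPerm ℂ shift).norm_map a).le
  -- The image of the bump under -d²/dx² + κ². The homogeneous part contributes nothing, so (H₀ +
  -- κ²)ψ is t times T on each edge.
  let T : EdgeL2 := (κ : ℂ) ^ 2 • edgeBump - edgeBumpDeriv₂
  refine not_diffOp_bounded_below hD (K * ((‖R‖ * ‖P T‖ + ‖P edgeBump‖) * ‖s‖)) fun a ha => ?_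
  set t : VertexData := s • Q (diffOp (discriminant r κ) a) with ht
  have ht_norm : ‖t‖ ≤ ‖s‖ * ‖diffOp (discriminant r κ) a‖ := by
    rw [ht, norm_smul]
    exact mul_le_mul_of_nonneg_left (hQ _) (norm_nonneg _)
  set a' : ℤ → ℂ := fun n => a (n, true) with ha'
  have hab : ∀ e, a e = a' e.1 := by
    rintro ⟨n, _ | _⟩
    · exact congrArg (fun f : VertexData => f (n, true)) ha
    · rfl
  have hte : ∀ n b, t (n, b) = s * (2 * discriminant r κ * a' (n + 1)
      - (a' (n + 1 + 1) + a' n)) := by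
    intro n b
    have h1 : t (n, b) = s * diffOp (discriminant r κ) a (n + 1, b) := rfl
    rw [h1, diffOp_apply, hab, hab, hab]
    simp only [add_sub_cancel_right]
  set χ : StateSpace := P (edgeL κ) a + P (edgeR κ) (Q a) with hχ
  have hχe : ∀ e, χ e = a e • edgeL κ + a (shift e) • edgeR κ := fun e => rfl
  set ψ : StateSpace := χ + P edgeBump t with hψ
  have hψe : ∀ e, ψ e = t e • edgeBump + a e • edgeL κ + a (shift e) • edgeR κ := by
    intro e
    rw [hψ, lp.coeFn_add, Pi.add_apply, hχe, hP]
    abel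
  have hgraph : (ψ, P T t - ((κ : ℂ) ^ 2) • ψ) ∈ hamiltonianGraph r := by
    refine ⟨fun e x => t e * bump x + a e * solL κ x + a (shift e) * solR κ x,
      fun e x => t e * bumpDeriv x + a e * solLDeriv κ x + a (shift e) * solRDeriv κ x,
      fun e => ?_, fun n => ?_⟩
    · have h := ((isH2_edgeBump.smul (t e)).add ((isH2_edgeL κ).smul (a e))).add
        ((isH2_edgeR κ).smul (a (shift e)))
      rw [← hψe] at h
      refine h.congr_deriv ?_
      change _ = -(t e • ((κ : ℂ) ^ 2 • edgeBump - edgeBumpDeriv₂) - (κ : ℂ) ^ 2 • ψ e)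
      rw [hψe]
      module
    · have h := deltaCoupling_of_recurrence (r := r) hκ
        (up := fun e x => t e * bump x) (vp := fun e x => t e * bumpDeriv x)
        (fun e => by simp [bump_zero]) (fun e => by simp [bumpDeriv_zero]) a' n (by
          simp only [Fintype.sum_bool, bump_pi, bumpDeriv_pi, hte, sub_add_cancel, hs]
          field_simp
          ring)
      simp only [bump_pi, mul_zero, sub_zero] at h
      simp only [hab]
      exact h
  obtain ⟨hd, hHψ⟩ := exists_hamiltonian_eq hgraph
  have hRψ : R (P T t) = ψ := by
    have h := hR ⟨ψ, hd⟩
    rw [hHψ] at h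
    refine Eq.trans (congrArg R ?_) h
    change _ = P T t - (κ : ℂ) ^ 2 • ψ - (-((κ : ℂ) ^ 2)) • ψ
    module
  have hχ_norm : ‖χ‖ ≤ (‖R‖ * ‖P T‖ + ‖P edgeBump‖) * ‖t‖ := by
    calc ‖χ‖ = ‖R (P T t) - P edgeBump t‖ := by rw [hRψ, hψ, add_sub_cancel_right]
      _ ≤ ‖R (P T t)‖ + ‖P edgeBump t‖ := norm_sub_le _ _
      _ ≤ ‖R‖ * (‖P T‖ * ‖t‖) + ‖P edgeBump‖ * ‖t‖ := by
          refine add_le_add ((R.le_opNorm _).trans ?_) ((P edgeBump).le_opNorm t)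
          exact mul_le_mul_of_nonneg_left ((P T).le_opNorm t) (norm_nonneg _)
      _ = _ := by ring
  calc ‖a‖ ≤ K * ‖χ‖ := lp_norm_le_of_le a χ hK0 fun e => by rw [hχe]; exact hK _ _
    _ ≤ K * ((‖R‖ * ‖P T‖ + ‖P edgeBump‖) * (‖s‖ * ‖diffOp (discriminant r κ) a‖)) := by
        refine mul_le_mul_of_nonneg_left (hχ_norm.trans ?_) hK0
        exact mul_le_mul_of_nonneg_left ht_norm (by positivity)
    _ = _ := by ring

end ChainGraph

end

/-! ### The criterion in extended real arithmetic. -/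

theorem corollary2p1 (α : EReal) (hα : α ≠ ⊥) (κ : ℝ) (hκ : 0 < κ) :
    (-(κ : ℂ) ^ 2) ∈ ChainGraph.spectrum (ChainGraph.hamiltonian α) ↔
      ((Real.cosh (κ * Real.pi) : EReal) +
        α / 4 * ((Real.sinh (κ * Real.pi) / κ : ℝ) : EReal)).abs ≤ 1 := by
  have hpos : 0 < Real.sinh (κ * Real.pi) / κ :=
    div_pos (Real.sinh_pos_iff.2 (mul_pos hκ Real.pi_pos)) hκ
  induction α with
  | bot => exact absurd rfl hα
  | top =>
    have h4 : (4 : EReal) = ((4 : ℝ) : EReal) := rfl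
    -- As sinh κπ / κ > 0, the left-hand side is +∞ and the inequality fails.
    rw [h4, EReal.top_div_of_pos_ne_top (by exact_mod_cast (by norm_num : (0 : ℝ) < 4))
      (EReal.coe_ne_top 4), EReal.top_mul_coe_of_pos hpos, EReal.coe_add_top, EReal.abs_top]
    exact iff_of_false (ChainGraph.notMem_spectrum_top hκ) (by simp)
  | coe r =>
    have hD : (Real.cosh (κ * Real.pi) : EReal) +
        (r : EReal) / 4 * ((Real.sinh (κ * Real.pi) / κ : ℝ) : EReal) =
        (ChainGraph.discriminant r κ : ℝ) := by
      have h4 : (4 : EReal) = ((4 : ℝ) : EReal) := rfl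
      rw [h4, ← EReal.coe_div, ← EReal.coe_mul, ← EReal.coe_add, ChainGraph.discriminant]
    rw [hD, EReal.abs_def, ENNReal.ofReal_le_one]
    refine ⟨fun h => ?_, ChainGraph.mem_spectrum_of_le_one hκ⟩
    by_contra hlt
    exact ChainGraph.notMem_spectrum_of_one_lt hκ (not_le.1 hlt) h
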